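/- Let $\mathbf{k}$ be an algebraically closed field, $\mathcal Q$ a finite quiver (paths are composed from left to right), $\mathcal I$ an ideal of the path algebra $\mathbf{k}\mathcal Q$, and suppose that $A=\mathbf{k}\mathcal Q/\mathcal I$ is a gentle algebra, i.e. $A$ is finite-dimensional, every vertex of $\mathcal Q$ has at most two incoming and at most two outgoing arrows, for arrows $a\neq b$ ending at the starting point of an arrow $c$ exactly one of $ac, bc$ lies in $\mathcal I$, for arrows $a\neq b$ starting at the end point of an arrow $c$ exactly one of $ca, cb$ lies in $\mathcal I$, and $\mathcal I$ is generated by paths of length two. Modules are right modules. A module $G$ over a ring $R$ is G-projective if there is an exact sequence $\cdots\to P_{-1}\to P_0\to P_1\to\cdots$ of finitely generated projective $R$-modules that stays exact under $\operatorname{Hom}_R(-,R)$ and has $G\cong\operatorname{im}(P_{-1}\to P_0)$. Let $C=\operatorname{End}_A\big(A\oplus\bigoplus_v G_v\big)$ be the Cohen--Macaulay--Auslander algebra of $A$, where $(G_v)_v$ is a set of representatives of the isomorphism classes of non-projective indecomposable G-projective $A$-modules and $A=\bigoplus_{w\in\mathcal Q_0}e_wA$ is the direct sum of the indecomposable projective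 ones; the product $fg$ in $C$ is $f\circ g$. Let $e_v\in C$ be the projection onto $G_v$ and $\epsilon_\star=\sum_{w\in\mathcal Q_0}\epsilon_w\in C$ the projection onto $A$, identify $A=\operatorname{End}_A(A)$ with $\epsilon_\star C\epsilon_\star$, and let $\mathfrak{res}_{\epsilon_\star}(X)=X\epsilon_\star$ be the restriction of a $C$-module $X$ to $A$. Let $G$ be a non-projective indecomposable G-projective $A$-module. Then there is exactly one $v$ with $G_v\cong G$, and for this $v$ the following hold. (1) $e_vC$ is an indecomposable projective $C$-module, $\mathfrak{res}_{\epsilon_\star}(e_vC)\cong G$, and $\mathfrak{res}_{\epsilon_\star}(e_vC)$ is G-projective over $A$. (2) The $C$-module $G\otimes_A\epsilon_\star C$ is neither projective nor G-projective, while $\mathfrak{res}_{\epsilon_\star}(G\otimes_A\epsilon_\star C)\cong G$, and this restriction is G-projective over $A$. -/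

import Mathlib

open scoped TensorProduct
open MulOpposite

noncomputable section

namespace GentleCM

/-! ### Path algebras and gentle algebras

Paths are composed from left to right: for arrows `a : u ⟶ v` and `b : v ⟶ w` the path "first `a`,
then `b`" is `ab`. -/

section PathAlgebra

universe u v w

/-- The path algebra `kQ` as a vector space: it has the set of all paths of the quiver
(including the trivial path `e_v` at every vertex `v`) as a basis. -/
def PathAlgebra (k : Type u) (V : Type v) [Field k] [Quiver.{w} V] : Type (max u v w) :=
  (Σ a b : V, Quiver.Path a b) →₀ k

namespace PathAlgebra

variable (k : Type u) (V : Type v) [Field k] [Quiver.{w} V]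

instance : AddCommGroup (PathAlgebra k V) :=
  inferInstanceAs (AddCommGroup ((Σ a b : V, Quiver.Path a b) →₀ k))

instance : Module k (PathAlgebra k V) :=
  inferInstanceAs (Module k ((Σ a b : V, Quiver.Path a b) →₀ k))

variable {V}

/-- A path as an element of the path algebra. -/
def ofPath {a b : V} (p : Quiver.Path a b) : PathAlgebra k V :=
  Finsupp.single (⟨a, b, p⟩ : Σ a b : V, Quiver.Path a b) (1 : k)

/-- The element of the path algebra given by an arrow. -/
def arrow {a b : V} (f : a ⟶ b) : PathAlgebra k V := ofPath k f.toPath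

/-- The trivial path at a vertex. -/
def vertex (v : V) : PathAlgebra k V := ofPath k (Quiver.Path.nil : Quiver.Path v v)

open scoped Classical in
/-- The product of two basis paths: their concatenation if the first one ends where the second
one starts, and zero otherwise. -/
def pathMul (p q : Σ a b : V, Quiver.Path a b) : (Σ a b : V, Quiver.Path a b) →₀ k :=
  if h : p.2.1 = q.1 then
    Finsupp.single ⟨p.1, q.2.1, p.2.2.comp (q.2.2.cast h.symm rfl)⟩ 1
  else 0

variable (V) in
/-- The bilinear extension of the product of paths. -/
def mulHom : ((Σ a b : V, Quiver.Path a b) →₀ k) →ₗ[k] ((Σ a b : V, Quiver.Path a b) →₀ k) →ₗ[k]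
    ((Σ a b : V, Quiver.Path a b) →₀ k) :=
  Finsupp.lsum k fun p => LinearMap.toSpanSingleton k _
    (Finsupp.lsum k fun q => LinearMap.toSpanSingleton k _ (pathMul k p q))

instance : Mul (PathAlgebra k V) := ⟨fun x y => mulHom k V x y⟩

instance [Fintype V] : One (PathAlgebra k V) := ⟨∑ v : V, vertex k v⟩

variable {k}

theorem ofPath_mul_ofPath {a b c d : V} (p : Quiver.Path a b) (q : Quiver.Path c d) :
    ofPath k p * ofPath k q = pathMul k ⟨a, b, p⟩ ⟨c, d, q⟩ := by
  change mulHom k V (Finsupp.single _ 1) (Finsupp.single _ 1) = _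
  simp [mulHom, LinearMap.toSpanSingleton_apply]

theorem ofPath_mul_ofPath_comp {a b c : V} (p : Quiver.Path a b) (q : Quiver.Path b c) :
    ofPath k p * ofPath k q = ofPath k (p.comp q) := by
  rw [ofPath_mul_ofPath]
  exact dif_pos rfl

theorem ofPath_mul_ofPath_of_ne {a b c d : V} (p : Quiver.Path a b) (q : Quiver.Path c d)
    (h : b ≠ c) : ofPath k p * ofPath k q = 0 := by
  rw [ofPath_mul_ofPath]
  exact dif_neg h

theorem induction_on {P : PathAlgebra k V → Prop} (x : PathAlgebra k V)
    (h0 : P 0) (hadd : ∀ x y, P x → P y → P (x + y))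
    (hp : ∀ (r : k) {a b : V} (p : Quiver.Path a b), P (r • ofPath k p)) : P x := by
  refine Finsupp.induction_linear x h0 hadd ?_
  rintro ⟨a, b, p⟩ r
  have : (Finsupp.single (⟨a, b, p⟩ : Σ a b : V, Quiver.Path a b) r) = r • ofPath k p :=
    (Finsupp.smul_single_one _ _).symm
  rw [this]; exact hp r p

theorem left_add (x y z : PathAlgebra k V) : (x + y) * z = x * z + y * z :=
  LinearMap.map_add₂ (mulHom k V) x y z
theorem right_add (x y z : PathAlgebra k V) : x * (y + z) = x * y + x * z :=
  (mulHom k V x).map_add y z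
theorem smul_left (r : k) (x y : PathAlgebra k V) : (r • x) * y = r • (x * y) :=
  LinearMap.map_smul₂ (mulHom k V) r x y
theorem smul_right (r : k) (x y : PathAlgebra k V) : x * (r • y) = r • (x * y) :=
  (mulHom k V x).map_smul r y
theorem zero_left (y : PathAlgebra k V) : 0 * y = 0 := LinearMap.map_zero₂ (mulHom k V) y
theorem zero_right (y : PathAlgebra k V) : y * 0 = 0 := (mulHom k V y).map_zero

theorem sum_mul' {ι : Type*} (s : Finset ι) (f : ι → PathAlgebra k V) (x : PathAlgebra k V) :
    (∑ i ∈ s, f i) * x = ∑ i ∈ s, f i * x :=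
  map_sum (⟨⟨fun y => y * x, zero_left x⟩, fun y z => left_add y z x⟩ :
    PathAlgebra k V →+ PathAlgebra k V) f s

theorem mul_sum' {ι : Type*} (s : Finset ι) (f : ι → PathAlgebra k V) (x : PathAlgebra k V) :
    x * (∑ i ∈ s, f i) = ∑ i ∈ s, x * f i :=
  map_sum (⟨⟨fun y => x * y, zero_right x⟩, fun y z => right_add x y z⟩ :
    PathAlgebra k V →+ PathAlgebra k V) f s

theorem assoc (x y z : PathAlgebra k V) : x * y * z = x * (y * z) := by
  induction x using induction_on with
  | h0 => simp only [zero_left]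
  | hadd x x' h h' => simp only [left_add, h, h']
  | hp r p =>
  induction y using induction_on with
  | h0 => simp only [zero_left, zero_right]
  | hadd x x' h h' => simp only [left_add, right_add, h, h']
  | hp s q =>
  induction z using induction_on with
  | h0 => simp only [zero_right]
  | hadd x x' h h' => simp only [right_add, h, h']
  | hp t l =>
  rename_i a b c d e f
  simp only [smul_left, smul_right]
  congr 3
  by_cases h1 : b = c
  · subst h1
    by_cases h2 : d = e
    · subst h2
      simp only [ofPath_mul_ofPath_comp, Quiver.Path.comp_assoc]
    · simp only [ofPath_mul_ofPath_comp, ofPath_mul_ofPath_of_ne _ _ h2, zero_right]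
  · by_cases h2 : d = e
    · subst h2
      simp only [ofPath_mul_ofPath_comp, ofPath_mul_ofPath_of_ne _ _ h1, zero_left]
    · simp only [ofPath_mul_ofPath_of_ne _ _ h1, ofPath_mul_ofPath_of_ne _ _ h2, zero_left,
        zero_right]

theorem one_mul' [Fintype V] (x : PathAlgebra k V) : 1 * x = x := by
  induction x using induction_on with
  | h0 => simp only [zero_right]
  | hadd x x' h h' => simp only [right_add, h, h']
  | hp r p =>
  rename_i a b
  rw [smul_right]
  congr 1
  change (∑ v : V, vertex k v) * ofPath k p = _
  rw [sum_mul', Finset.sum_eq_single a]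
  · rw [vertex, ofPath_mul_ofPath_comp, Quiver.Path.nil_comp]
  · intro v _ hv
    rw [vertex, ofPath_mul_ofPath_of_ne _ _ hv]
  · intro h; exact absurd (Finset.mem_univ a) h

theorem mul_one' [Fintype V] (x : PathAlgebra k V) : x * 1 = x := by
  induction x using induction_on with
  | h0 => simp only [zero_left]
  | hadd x x' h h' => simp only [left_add, h, h']
  | hp r p =>
  rename_i a b
  rw [smul_left]
  congr 1
  change ofPath k p * (∑ v : V, vertex k v) = _
  rw [mul_sum', Finset.sum_eq_single b]
  · rw [vertex, ofPath_mul_ofPath_comp, Quiver.Path.comp_nil]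
  · intro v _ hv
    rw [vertex, ofPath_mul_ofPath_of_ne _ _ hv.symm]
  · intro h; exact absurd (Finset.mem_univ b) h

variable [Fintype V]

instance : Ring (PathAlgebra k V) :=
  { (inferInstance : AddCommGroup (PathAlgebra k V)) with
    mul := (· * ·)
    one := 1
    left_distrib := right_add
    right_distrib := left_add
    zero_mul := zero_left
    mul_zero := zero_right
    mul_assoc := assoc
    one_mul := one_mul'
    mul_one := mul_one' }

instance : Algebra k (PathAlgebra k V) :=
  Algebra.ofModule smul_left smul_right

end PathAlgebra

variable {k : Type u} {V : Type v} [Field k] [Fintype V] [Quiver.{w} V]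

/-- `(Q, I)` is a gentle pair. In `G2` and `G3`, `(⟨u, a⟩ : Quiver.Costar v) ≠ ⟨u', b⟩` says that
`a` and `b` are different arrows ending at `v`, and likewise for `Quiver.Star`. -/
structure IsGentlePair (I : TwoSidedIdeal (PathAlgebra k V)) : Prop where
  /-- There are at most two incoming arrows at every vertex. -/
  G1_in : ∀ v : V, Nat.card (Quiver.Costar v) ≤ 2
  /-- There are at most two outgoing arrows at every vertex. -/
  G1_out : ∀ v : V, Nat.card (Quiver.Star v) ≤ 2
  G2 : ∀ {u u' v w : V} (a : u ⟶ v) (b : u' ⟶ v) (c : v ⟶ w),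
    (⟨u, a⟩ : Quiver.Costar v) ≠ ⟨u', b⟩ →
      Xor (PathAlgebra.ofPath k (a.toPath.comp c.toPath) ∈ I)
        (PathAlgebra.ofPath k (b.toPath.comp c.toPath) ∈ I)
  G3 : ∀ {u v w w' : V} (a : v ⟶ w) (b : v ⟶ w') (c : u ⟶ v),
    (⟨w, a⟩ : Quiver.Star v) ≠ ⟨w', b⟩ →
      Xor (PathAlgebra.ofPath k (c.toPath.comp a.toPath) ∈ I)
        (PathAlgebra.ofPath k (c.toPath.comp b.toPath) ∈ I)
  /-- The ideal is generated by paths of length two. -/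
  G4 : ∃ S : Set (PathAlgebra k V),
    (∀ x ∈ S, ∃ (u v w : V) (a : u ⟶ v) (b : v ⟶ w),
      x = PathAlgebra.ofPath k (a.toPath.comp b.toPath)) ∧
    I = TwoSidedIdeal.span S

/-- The algebra `kQ/I` of a bound quiver. -/
def BoundQuiverAlgebra (I : TwoSidedIdeal (PathAlgebra k V)) : Type (max u v w) :=
  I.ringCon.Quotient

instance (I : TwoSidedIdeal (PathAlgebra k V)) : Ring (BoundQuiverAlgebra I) :=
  inferInstanceAs (Ring I.ringCon.Quotient)

instance (I : TwoSidedIdeal (PathAlgebra k V)) : Algebra k (BoundQuiverAlgebra I) :=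
  inferInstanceAs (Algebra k I.ringCon.Quotient)

/-- The quotient map `kQ → kQ/I`. -/
def BoundQuiverAlgebra.mk (I : TwoSidedIdeal (PathAlgebra k V)) :
    PathAlgebra k V →ₐ[k] BoundQuiverAlgebra I :=
  RingCon.mkₐ k I.ringCon

/-- `kQ/I` is a gentle algebra: it is finite-dimensional and `(Q, I)` is a gentle pair. -/
structure IsGentleAlgebra (I : TwoSidedIdeal (PathAlgebra k V)) : Prop where
  gentlePair : IsGentlePair I
  finiteDimensional : Module.Finite k (BoundQuiverAlgebra I)

end PathAlgebra

/-! ### Modules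

A right module over a ring `R` is a `Module Rᵐᵒᵖ M`; the product `m · r` is `op r • m`. -/

section Modules

universe u v

/-- A nonzero module that is not the direct sum of two nonzero submodules. -/
def IsIndecomposable (S : Type u) (M : Type v) [Ring S] [AddCommGroup M] [Module S M] : Prop :=
  Nontrivial M ∧ ∀ p q : Submodule S M, IsCompl p q → p = ⊥ ∨ q = ⊥

/-- A right `R`-module `M` is Gorenstein-projective if there is an exact sequence
`⋯ → P (-1) → P 0 → P 1 → ⋯` of finitely generated projective right `R`-modules which stays exact
under `Hom_R(-, R)` and in which `M` is isomorphic to the image of `P (-1) → P 0`. -/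
def IsGorensteinProjective (R : Type u) (M : Type v) [Ring R] [AddCommGroup M] [Module Rᵐᵒᵖ M] :
    Prop :=
  ∃ (P : ℤ → Type u) (_ : ∀ n, AddCommGroup (P n)) (_ : ∀ n, Module Rᵐᵒᵖ (P n))
    (d : ∀ n, P n →ₗ[Rᵐᵒᵖ] P (n + 1)),
    (∀ n, Module.Finite Rᵐᵒᵖ (P n)) ∧
    (∀ n, Module.Projective Rᵐᵒᵖ (P n)) ∧
    (∀ n, Function.Exact (d n) (d (n + 1))) ∧
    (∀ n, Function.Exact
      (fun f : P (n + 1 + 1) →ₗ[Rᵐᵒᵖ] R => f ∘ₗ d (n + 1))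
      (fun f : P (n + 1) →ₗ[Rᵐᵒᵖ] R => f ∘ₗ d n)) ∧
    Nonempty (M ≃ₗ[Rᵐᵒᵖ] LinearMap.range (d (-1)))

/-- The right ideal `eR`, as a right `R`-module. -/
def rightIdeal {R : Type u} [Ring R] (e : R) : Submodule Rᵐᵒᵖ R where
  carrier := Set.range fun x => e * x
  add_mem' := by
    rintro _ _ ⟨x, rfl⟩ ⟨y, rfl⟩
    exact ⟨x + y, mul_add _ _ _⟩
  zero_mem' := ⟨0, mul_zero _⟩
  smul_mem' := by
    rintro r _ ⟨x, rfl⟩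
    exact ⟨x * r.unop, (mul_assoc _ _ _).symm⟩

end Modules

/-! ### Restriction and induction along an idempotent

Let `j : A → C` be a map that respects sums and products, with `j 1 = ε` (so `ε` is an idempotent).
It is used below for a `j` that is an isomorphism of `A` onto the corner ring `ε C ε`. -/

section Corner

universe u v w z

variable {A : Type u} {C : Type v} [Ring A] [Ring C] (j : A →ₙ+* C)

theorem map_one_mul_map (a : A) : j 1 * j a = j a := by rw [← map_mul, one_mul]

theorem map_mul_map_one (a : A) : j a * j 1 = j a := by rw [← map_mul, mul_one]

/-- The restriction `X ↦ X ε` of right `C`-modules to right `A`-modules: as a group it is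
`{x · ε | x ∈ X}`. -/
def res (X : Type w) [AddCommGroup X] [Module Cᵐᵒᵖ X] : AddSubgroup X :=
  (DistribSMul.toAddMonoidHom X (op (j 1))).range

variable {X : Type w} [AddCommGroup X] [Module Cᵐᵒᵖ X]

theorem map_smul_mem_res (a : A) (x : X) : op (j a) • x ∈ res j X :=
  ⟨op (j a) • x, by
    change op (j 1) • op (j a) • x = _
    rw [smul_smul, ← op_mul, map_mul_map_one]⟩

/-- The right action of `A` on `X ε` through `A → ε C ε`. -/
instance : SMul Aᵐᵒᵖ (res j X) :=
  ⟨fun a x => ⟨op (j a.unop) • (x : X), map_smul_mem_res j _ _⟩⟩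

theorem res_coe_smul (a : Aᵐᵒᵖ) (x : res j X) :
    ((a • x : res j X) : X) = op (j a.unop) • (x : X) := rfl

instance : Module Aᵐᵒᵖ (res j X) where
  one_smul := by
    rintro ⟨_, x, rfl⟩
    apply Subtype.ext
    change op (j 1) • op (j 1) • x = op (j 1) • x
    rw [smul_smul, ← op_mul, map_mul_map_one]
  mul_smul a b x := by
    apply Subtype.ext
    simp only [res_coe_smul, unop_mul, map_mul, op_mul, mul_smul]
  smul_zero a := by
    apply Subtype.ext
    simp [res_coe_smul]
  smul_add a x y := by
    apply Subtype.ext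
    simp [res_coe_smul]
  add_smul a b x := by
    apply Subtype.ext
    simp [res_coe_smul, add_smul]
  zero_smul x := by
    apply Subtype.ext
    simp [res_coe_smul]

/-- The left action of `A` on the right ideal `ε C` through `A → ε C ε`. -/
instance : SMul A (rightIdeal (j 1)) :=
  ⟨fun a x => ⟨j a * (x : C), j a * (x : C), by
    change j 1 * (j a * (x : C)) = _
    rw [← mul_assoc, map_one_mul_map]⟩⟩

theorem rightIdeal_coe_smul (a : A) (x : rightIdeal (j 1)) :
    ((a • x : rightIdeal (j 1)) : C) = j a * (x : C) := rfl

instance : Module A (rightIdeal (j 1)) where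
  one_smul := by
    rintro ⟨_, x, rfl⟩
    apply Subtype.ext
    change j 1 * (j 1 * x) = j 1 * x
    rw [← mul_assoc, map_one_mul_map]
  mul_smul a b x := by
    apply Subtype.ext
    simp only [rightIdeal_coe_smul, map_mul, mul_assoc]
  smul_zero a := by
    apply Subtype.ext
    simp [rightIdeal_coe_smul]
  smul_add a x y := by
    apply Subtype.ext
    simp [rightIdeal_coe_smul, mul_add]
  add_smul a b x := by
    apply Subtype.ext
    simp [rightIdeal_coe_smul, add_mul]
  zero_smul x := by
    apply Subtype.ext
    simp [rightIdeal_coe_smul]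

instance : SMulCommClass A Cᵐᵒᵖ (rightIdeal (j 1)) where
  smul_comm a c x := by
    apply Subtype.ext
    change j a * ((x : C) * c.unop) = j a * (x : C) * c.unop
    rw [mul_assoc]

/-- The tensor product `G ⊗_A X` of a right `A`-module `G` and an `A`-`C`-bimodule `X`, as a right
`C`-module: the quotient of `X ⊗_ℤ G` (on which `C` acts through `X`) by all differences
`(a x) ⊗ g - x ⊗ (g a)`. These differences are stable under `C`, so that the `C`-submodule they
span is the subgroup they generate. -/
def BimoduleTensor (A : Type u) (C : Type v) [Ring A] [Ring C]
    (G : Type w) [AddCommGroup G] [Module Aᵐᵒᵖ G]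
    (X : Type z) [AddCommGroup X] [Module A X] [Module Cᵐᵒᵖ X] [SMulCommClass A Cᵐᵒᵖ X] :
    Type (max w z) :=
  (X ⊗[ℤ] G) ⧸ Submodule.span Cᵐᵒᵖ
    {t : X ⊗[ℤ] G | ∃ (a : A) (x : X) (g : G), t = (a • x) ⊗ₜ[ℤ] g - x ⊗ₜ[ℤ] (op a • g)}

section

variable (A : Type u) (C : Type v) [Ring A] [Ring C] (G : Type w) [AddCommGroup G] [Module Aᵐᵒᵖ G]
  (X : Type z) [AddCommGroup X] [Module A X] [Module Cᵐᵒᵖ X] [SMulCommClass A Cᵐᵒᵖ X]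

instance : AddCommGroup (BimoduleTensor A C G X) :=
  inferInstanceAs (AddCommGroup ((X ⊗[ℤ] G) ⧸ Submodule.span Cᵐᵒᵖ
    {t : X ⊗[ℤ] G | ∃ (a : A) (x : X) (g : G), t = (a • x) ⊗ₜ[ℤ] g - x ⊗ₜ[ℤ] (op a • g)}))

instance : Module Cᵐᵒᵖ (BimoduleTensor A C G X) :=
  inferInstanceAs (Module Cᵐᵒᵖ ((X ⊗[ℤ] G) ⧸ Submodule.span Cᵐᵒᵖ
    {t : X ⊗[ℤ] G | ∃ (a : A) (x : X) (g : G), t = (a • x) ⊗ₜ[ℤ] g - x ⊗ₜ[ℤ] (op a • g)}))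

end

/-- The induced right `C`-module `G ⊗_A ε C` of a right `A`-module `G`. -/
abbrev ind (G : Type w) [AddCommGroup G] [Module Aᵐᵒᵖ G] : Type (max w v) :=
  BimoduleTensor A C G (rightIdeal (j 1))

end Corner

/-! ### The Cohen-Macaulay-Auslander algebra -/

section CMAuslander

universe u

variable (A : Type u) [Ring A]

/-- The non-projective indecomposable Gorenstein-projective right
`A`-modules: quotients `A ^ n / K`. Every finitely generated right `A`-module is isomorphic to a
module of the form `A ^ n / K`, so all isomorphism classes occur. -/
def NPGorensteinProjective : Type u :=
  {K : Σ n : ℕ, Submodule Aᵐᵒᵖ (Fin n → A) //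
    IsIndecomposable Aᵐᵒᵖ ((Fin K.1 → A) ⧸ K.2) ∧
    IsGorensteinProjective A ((Fin K.1 → A) ⧸ K.2) ∧
    ¬ Module.Projective Aᵐᵒᵖ ((Fin K.1 → A) ⧸ K.2)}

instance isoSetoid : Setoid (NPGorensteinProjective A) where
  r K L := Nonempty
    (((Fin K.1.1 → A) ⧸ K.1.2) ≃ₗ[Aᵐᵒᵖ] ((Fin L.1.1 → A) ⧸ L.1.2))
  iseqv :=
    ⟨fun _ => ⟨LinearEquiv.refl _ _⟩, fun ⟨e⟩ => ⟨e.symm⟩, fun ⟨e⟩ ⟨f⟩ => ⟨e.trans f⟩⟩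

/-- The set of isomorphism classes of non-projective indecomposable Gorenstein-projective right
`A`-modules. Together with the vertices of the quiver of `A` (which stand for the indecomposable
projective modules) these are the vertices of the Cohen-Macaulay-Auslander algebra. -/
abbrev GVertex : Type u := Quotient (isoSetoid A)

variable {A}

/-- A representative of the isomorphism class `v`. -/
abbrev GVertex.Mod (v : GVertex A) : Type u :=
  (Fin (Quotient.out v).1.1 → A) ⧸ (Quotient.out v).1.2

variable (A)

/-- The direct sum of one representative of every isomorphism class of indecomposable
Gorenstein-projective right `A`-modules, for a basic algebra `A = kQ/I`: the projective ones are the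
`e_w A` for the vertices `w` of `Q`, with (internal) direct sum `A = ⨁ e_w A`, and the
non-projective ones are the `v.Mod`. -/
def CMGenerator : Type u := A × DirectSum (GVertex A) fun v => v.Mod

instance : AddCommGroup (CMGenerator A) :=
  inferInstanceAs (AddCommGroup (A × DirectSum (GVertex A) fun v => v.Mod))

instance : Module Aᵐᵒᵖ (CMGenerator A) :=
  inferInstanceAs (Module Aᵐᵒᵖ (A × DirectSum (GVertex A) fun v => v.Mod))

namespace CMGenerator

/-- The inclusion of the summand `A`. -/
def inA : A →ₗ[Aᵐᵒᵖ] CMGenerator A := LinearMap.inl Aᵐᵒᵖ A (DirectSum (GVertex A) fun v => v.Mod)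

/-- The projection onto the summand `A`. -/
def prA : CMGenerator A →ₗ[Aᵐᵒᵖ] A := LinearMap.fst Aᵐᵒᵖ A (DirectSum (GVertex A) fun v => v.Mod)

variable {A}

open scoped Classical in
/-- The inclusion of the summand `v.Mod`. -/
def inG (v : GVertex A) : v.Mod →ₗ[Aᵐᵒᵖ] CMGenerator A :=
  LinearMap.inr Aᵐᵒᵖ A (DirectSum (GVertex A) fun v => v.Mod) ∘ₗ
    DirectSum.lof Aᵐᵒᵖ (GVertex A) (fun v => v.Mod) v

/-- The projection onto the summand `v.Mod`. -/
def prG (v : GVertex A) : CMGenerator A →ₗ[Aᵐᵒᵖ] v.Mod :=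
  DirectSum.component Aᵐᵒᵖ (GVertex A) (fun v => v.Mod) v ∘ₗ
    LinearMap.snd Aᵐᵒᵖ A (DirectSum (GVertex A) fun v => v.Mod)

theorem prA_inA (a : A) : prA A (inA A a) = a := rfl

theorem prG_inG (v : GVertex A) (x : v.Mod) : prG v (inG v x) = x := by
  classical
  exact DirectSum.component.lof_self (R := Aᵐᵒᵖ) (M := fun v : GVertex A => v.Mod) v x

end CMGenerator

/-- The Cohen-Macaulay-Auslander algebra of `A`: the endomorphism ring of the direct sum of all
indecomposable Gorenstein-projective right `A`-modules. The product `f * g` is "first `g`, then `f`";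
with it the endomorphism ring of the right module `A` is `A`, acting by left multiplication. -/
def CMAuslanderAlgebra : Type u := Module.End Aᵐᵒᵖ (CMGenerator A)

instance : Ring (CMAuslanderAlgebra A) :=
  inferInstanceAs (Ring (Module.End Aᵐᵒᵖ (CMGenerator A)))

/-- The inclusion of `A = End_A(A)` into the Cohen-Macaulay-Auslander algebra: `a` acts on the summand
`A` by left multiplication and as zero on the other summands. -/
def cornerHom : A →ₙ+* CMAuslanderAlgebra A where
  toFun a := CMGenerator.inA A ∘ₗ Module.toModuleEnd Aᵐᵒᵖ A a ∘ₗ CMGenerator.prA A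
  map_mul' a b := by
    refine LinearMap.ext fun x => ?_
    change CMGenerator.inA A ((a * b) * CMGenerator.prA A x) =
      CMGenerator.inA A (a * (b * CMGenerator.prA A x))
    rw [mul_assoc]
  map_zero' := by
    refine LinearMap.ext fun x => ?_
    change CMGenerator.inA A (0 * CMGenerator.prA A x) = 0
    rw [zero_mul, map_zero]
  map_add' a b := by
    refine LinearMap.ext fun x => ?_
    change CMGenerator.inA A ((a + b) * CMGenerator.prA A x) =
      CMGenerator.inA A (a * CMGenerator.prA A x) + CMGenerator.inA A (b * CMGenerator.prA A x)
    rw [add_mul, map_add]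

/-- The idempotent `ε⋆`: the projection onto the summand `A`. -/
def epsStar : CMAuslanderAlgebra A := CMGenerator.inA A ∘ₗ CMGenerator.prA A

variable {A} in
/-- The idempotent `e_v` at the vertex `v` given by a non-projective indecomposable
Gorenstein-projective module: the projection onto the corresponding summand. -/
def vertexIdempotent (v : GVertex A) : CMAuslanderAlgebra A :=
  CMGenerator.inG v ∘ₗ CMGenerator.prG v

variable {A} in
theorem vertexIdempotent_mul_self (v : GVertex A) :
    vertexIdempotent v * vertexIdempotent v = vertexIdempotent v :=
  LinearMap.ext fun _ => congrArg (CMGenerator.inG v) (CMGenerator.prG_inG v _)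

theorem cornerHom_one : cornerHom A 1 = epsStar A :=
  LinearMap.ext fun x => congrArg (CMGenerator.inA A) (one_mul (CMGenerator.prA A x))

theorem cornerHom_injective : Function.Injective (cornerHom A) := by
  intro a b h
  have := congrArg (fun f : Module.End Aᵐᵒᵖ (CMGenerator A) =>
    CMGenerator.prA A (f (CMGenerator.inA A 1))) h
  change a * 1 = b * 1 at this
  simpa only [mul_one] using this

/-- `A` is identified with the whole corner ring `ε⋆ C ε⋆`. -/
theorem range_cornerHom :
    Set.range (cornerHom A) = {f | ∃ c, f = epsStar A * c * epsStar A} := by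
  ext f
  constructor
  · rintro ⟨a, rfl⟩
    exact ⟨cornerHom A a, by simp only [← cornerHom_one, ← map_mul, one_mul, mul_one]⟩
  · rintro ⟨c, rfl⟩
    let c' : Module.End Aᵐᵒᵖ (CMGenerator A) := c
    let b : A := CMGenerator.prA A (c' (CMGenerator.inA A 1))
    refine ⟨b, LinearMap.ext fun x => ?_⟩
    change CMGenerator.inA A (b * CMGenerator.prA A x) =
      CMGenerator.inA A (CMGenerator.prA A (c' (CMGenerator.inA A (CMGenerator.prA A x))))
    have h : CMGenerator.prA A x = op (CMGenerator.prA A x) • (1 : A) := by simp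
    conv_rhs => rw [h, map_smul, map_smul, map_smul]
    rfl

end CMAuslander

/-- `ε⋆` is the sum of the idempotents `ε_w` at the vertices `w` of the quiver. -/
theorem epsStar_eq_sum {k V : Type*} [Field k] [Fintype V] [Quiver V]
    (I : TwoSidedIdeal (PathAlgebra k V)) :
    epsStar (BoundQuiverAlgebra I) =
      ∑ w : V, cornerHom (BoundQuiverAlgebra I) (BoundQuiverAlgebra.mk I (PathAlgebra.vertex k w)) := by
  rw [← map_sum, ← map_sum, ← cornerHom_one]
  exact congrArg _ (map_one (BoundQuiverAlgebra.mk I)).symm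

end GentleCM

end

open GentleCM

/-!
Let `M` be the direct sum of `A` and of representatives of all non-projective indecomposable
Gorenstein-projective modules, `C = End_A(M)`, and `ε` the projection of `M` onto `A`. Everything
is read off from the functor `Hom_A(M, -)` from right `A`-modules to right `C`-modules (`HomM`).
It carries direct summands of powers of `M` to projective modules, and its composition with
restriction to `A` is the identity (`HomM.resEquiv`), because `Hom_A(M, N) ε = Hom_A(A, N)`.

The module `e_v C` is `Hom_A(M, G_v)`. Its idempotent endomorphisms are those of `G_v`, so it is
indecomposable.

For a presentation `A ^ m → A ^ n → G → 0`, the sequence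
`Hom_A(M, A ^ m) → Hom_A(M, A ^ n) → G ⊗_A εC → 0`
is exact (`indCover_exact`). If the last map splits, then restriction to `A` shows that
`A ^ n → G` splits (`projective_of_projective_ind`); so `G ⊗_A εC` is not projective. The
kernel on the left is `Hom_A(M, K)` for the second syzygy `K` of `G`. As `A` is finite-dimensional
and `K` is Gorenstein-projective, `K` is a finite direct sum of indecomposable
Gorenstein-projective modules, so `Hom_A(M, K)` is projective and `G ⊗_A εC` has projective
dimension at most two. A Gorenstein-projective module of finite projective dimension is projective
(`IsGorensteinProjective.projective_of_resolution`), so `G ⊗_A εC` is not Gorenstein-projective.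

This uses that syzygies and direct summands of Gorenstein-projective modules are
Gorenstein-projective. With complexes of finitely generated modules the statement on summands is
not formal, as infinite direct sums are not available. Instead, a complex is regarded as a doubly
infinite sequence of modules each of which is a cosyzygy of the preceding one (`IsCosyzygy`), and
the class of all summands of terms of such sequences, up to projective modules, is shown to
contain syzygies and cosyzygies of its members by Schanuel's lemma and its dual
(`IsChainSummand.ker`, `IsChainSummand.exists_next`). Splicing the resulting short exact sequences
gives the complexes for all members of the class (`isGorensteinProjective_of_class`).
-/

noncomputable section

namespace GentleCM

universe u v w w' w''

section GorensteinProjective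

variable {A : Type u} [Ring A]

theorem IsGorensteinProjective.congr {M : Type w} {N : Type w'} [AddCommGroup M] [Module Aᵐᵒᵖ M]
    [AddCommGroup N] [Module Aᵐᵒᵖ N] (h : IsGorensteinProjective A M) (e : M ≃ₗ[Aᵐᵒᵖ] N) :
    IsGorensteinProjective A N := by
  obtain ⟨P, i, j, d, h1, h2, h3, h4, ⟨f⟩⟩ := h
  exact ⟨P, i, j, d, h1, h2, h3, h4, ⟨e.symm.trans f⟩⟩

theorem IsGorensteinProjective.finite {M : Type w} [AddCommGroup M] [Module Aᵐᵒᵖ M]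
    (h : IsGorensteinProjective A M) : Module.Finite Aᵐᵒᵖ M := by
  obtain ⟨P, i, j, d, h1, h2, h3, h4, ⟨f⟩⟩ := h
  have := h1 (-1)
  exact Module.Finite.equiv f.symm

variable (A) in
/-- The regular right module `A` is free on one generator over `Aᵐᵒᵖ`. -/
def opEquiv : A ≃ₗ[Aᵐᵒᵖ] Aᵐᵒᵖ where
  toFun := op
  invFun := unop
  map_add' _ _ := rfl
  map_smul' _ _ := rfl
  left_inv _ := rfl
  right_inv _ := rfl

theorem exists_free_cover (N : Type w) [AddCommGroup N] [Module Aᵐᵒᵖ N] [Module.Finite Aᵐᵒᵖ N] :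
    ∃ (n : ℕ) (π : (Fin n → A) →ₗ[Aᵐᵒᵖ] N), Function.Surjective π := by
  obtain ⟨n, f, hf⟩ := Module.Finite.exists_fin' Aᵐᵒᵖ N
  exact ⟨n, f ∘ₗ (LinearEquiv.piCongrRight fun _ => opEquiv A).toLinearMap,
    hf.comp (LinearEquiv.surjective _)⟩

instance : Module.Projective Aᵐᵒᵖ A := Module.Projective.of_equiv (opEquiv A).symm

instance (n : ℕ) : Module.Projective Aᵐᵒᵖ (Fin n → A) :=
  Module.Projective.of_equiv (LinearEquiv.piCongrRight fun _ => (opEquiv A).symm)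

instance : Module.Finite Aᵐᵒᵖ A := Module.Finite.equiv (opEquiv A).symm

theorem exists_retract_free (Q : Type w) [AddCommGroup Q] [Module Aᵐᵒᵖ Q] [Module.Finite Aᵐᵒᵖ Q]
    [Module.Projective Aᵐᵒᵖ Q] :
    ∃ (n : ℕ) (i : Q →ₗ[Aᵐᵒᵖ] (Fin n → A)) (r : (Fin n → A) →ₗ[Aᵐᵒᵖ] Q), r ∘ₗ i = .id := by
  obtain ⟨n, r, hr⟩ := exists_free_cover (A := A) Q
  obtain ⟨i, hi⟩ := Module.projective_lifting_property r .id hr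
  exact ⟨n, i, r, hi⟩

/-- If all maps to `A` extend along `ι`, so do all maps to a retract of `A ^ n`. -/
theorem exists_extend_of_retract {Z : Type w} {P : Type w'} {Q : Type w''}
    [AddCommGroup Z] [Module Aᵐᵒᵖ Z]
    [AddCommGroup P] [Module Aᵐᵒᵖ P] [AddCommGroup Q] [Module Aᵐᵒᵖ Q] {ι : Z →ₗ[Aᵐᵒᵖ] P}
    (hι : ∀ f : Z →ₗ[Aᵐᵒᵖ] A, ∃ g : P →ₗ[Aᵐᵒᵖ] A, g ∘ₗ ι = f) {n : ℕ}
    (i : Q →ₗ[Aᵐᵒᵖ] (Fin n → A)) (r : (Fin n → A) →ₗ[Aᵐᵒᵖ] Q) (hri : r ∘ₗ i = .id)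
    (f : Z →ₗ[Aᵐᵒᵖ] Q) : ∃ g : P →ₗ[Aᵐᵒᵖ] Q, g ∘ₗ ι = f := by
  choose g hg using fun t : Fin n => hι (LinearMap.proj t ∘ₗ i ∘ₗ f)
  refine ⟨r ∘ₗ LinearMap.pi g, LinearMap.ext fun z => ?_⟩
  have h : LinearMap.pi g (ι z) = i (f z) := funext fun t => LinearMap.congr_fun (hg t) z
  exact (congrArg r h).trans (LinearMap.congr_fun hri _)

theorem exists_extend {Z : Type w} {P : Type w'} {Q : Type w''} [AddCommGroup Z] [Module Aᵐᵒᵖ Z]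
    [AddCommGroup P] [Module Aᵐᵒᵖ P] [AddCommGroup Q] [Module Aᵐᵒᵖ Q] [Module.Finite Aᵐᵒᵖ Q]
    [Module.Projective Aᵐᵒᵖ Q] {ι : Z →ₗ[Aᵐᵒᵖ] P}
    (hι : ∀ f : Z →ₗ[Aᵐᵒᵖ] A, ∃ g : P →ₗ[Aᵐᵒᵖ] A, g ∘ₗ ι = f)
    (f : Z →ₗ[Aᵐᵒᵖ] Q) : ∃ g : P →ₗ[Aᵐᵒᵖ] Q, g ∘ₗ ι = f := by
  obtain ⟨n, i, r, hri⟩ := exists_retract_free (A := A) Q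
  exact exists_extend_of_retract hι i r hri f

theorem exists_factor {R P N L : Type*} [Ring R] [AddCommGroup P] [Module R P] [AddCommGroup N]
    [Module R N] [AddCommGroup L] [Module R L] {π : P →ₗ[R] N} (hπ : Function.Surjective π)
    (f : P →ₗ[R] L) (h : LinearMap.ker π ≤ LinearMap.ker f) : ∃ g : N →ₗ[R] L, g ∘ₗ π = f := by
  refine ⟨(LinearMap.ker π).liftQ f h ∘ₗ (π.quotKerEquivOfSurjective hπ).symm.toLinearMap,
    LinearMap.ext fun x => ?_⟩
  have : (π.quotKerEquivOfSurjective hπ).symm (π x) = Submodule.Quotient.mk x := by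
    rw [LinearEquiv.symm_apply_eq]; rfl
  exact congrArg ((LinearMap.ker π).liftQ f h) this

/-! ### Schanuel's lemma -/

section Schanuel

variable {R : Type*} [Ring R]
  {K : Type*} {P : Type*} {N : Type*} {K' : Type*} {P' : Type*} {N' : Type*}
  [AddCommGroup K] [Module R K] [AddCommGroup P] [Module R P] [AddCommGroup N] [Module R N]
  [AddCommGroup K'] [Module R K'] [AddCommGroup P'] [Module R P'] [AddCommGroup N'] [Module R N']

/-- Schanuel's lemma. -/
theorem schanuel {ι : K →ₗ[R] P} {π : P →ₗ[R] N} {ι' : K' →ₗ[R] P'} {π' : P' →ₗ[R] N}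
    (hι : Function.Injective ι) (h : Function.Exact ι π)
    (hι' : Function.Injective ι') (h' : Function.Exact ι' π')
    {a : P →ₗ[R] P'} {b : P' →ₗ[R] P} (ha : π' ∘ₗ a = π) (hb : π ∘ₗ b = π') :
    Nonempty ((K × P') ≃ₗ[R] (K' × P)) := by
  have ha x : π' (a x) = π x := LinearMap.congr_fun ha x
  have hb x : π (b x) = π' x := LinearMap.congr_fun hb x
  -- Two shears of `P × P'` carry `ker π × P'` onto `P × ker π'`.
  let f : K × P' →ₗ[R] P' × P :=
    { toFun := fun z => (z.2 + a (ι z.1 - b z.2), ι z.1 - b z.2)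
      map_add' := fun x y => by
        ext <;> simp only [Prod.fst_add, Prod.snd_add, map_add, map_sub] <;> abel
      map_smul' := fun r x => by
        ext <;> simp [smul_sub] }
  have hf : Function.Injective f := by
    rw [← LinearMap.ker_eq_bot, LinearMap.ker_eq_bot']
    rintro ⟨x, y⟩ hxy
    have h2 : ι x - b y = 0 := congrArg Prod.snd hxy
    have h1 : y + a (ι x - b y) = 0 := congrArg Prod.fst hxy
    rw [h2, map_zero, add_zero] at h1
    subst h1
    rw [map_zero, sub_zero] at h2
    rw [(map_eq_zero_iff ι hι).1 h2]
    rfl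
  let g : K' × P →ₗ[R] P' × P := ι'.prodMap .id
  have hg : Function.Injective g := hι'.prodMap Function.injective_id
  have hfg : LinearMap.range f = LinearMap.range g := by
    apply le_antisymm
    · rintro _ ⟨⟨x, y⟩, rfl⟩
      obtain ⟨z, hz⟩ := (h' (y + a (ι x - b y))).1 (by
        rw [map_add, ha, map_sub, h.apply_apply_eq_zero, hb]; abel)
      exact ⟨(z, ι x - b y), Prod.ext hz rfl⟩
    · rintro _ ⟨⟨z, p⟩, rfl⟩
      obtain ⟨x, hx⟩ := (h (p + b (ι' z - a p))).1 (by
        rw [map_add, hb, map_sub, h'.apply_apply_eq_zero, ha]; abel)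
      refine ⟨(x, ι' z - a p), Prod.ext ?_ ?_⟩
      · change ι' z - a p + a (ι x - b (ι' z - a p)) = ι' z
        rw [hx]; simp
      · change ι x - b (ι' z - a p) = p
        rw [hx]; simp
  exact ⟨(LinearEquiv.ofInjective f hf).trans
    ((LinearEquiv.ofEq _ _ hfg).trans (LinearEquiv.ofInjective g hg).symm)⟩

/-- The dual of Schanuel's lemma. -/
theorem schanuel_dual {ι : K →ₗ[R] P} {π : P →ₗ[R] N} {ι' : K →ₗ[R] P'} {π' : P' →ₗ[R] N'}
    (h : Function.Exact ι π) (hπ : Function.Surjective π)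
    (h' : Function.Exact ι' π') (hπ' : Function.Surjective π')
    {a : P →ₗ[R] P'} {b : P' →ₗ[R] P} (ha : a ∘ₗ ι = ι') (hb : b ∘ₗ ι' = ι) :
    Nonempty ((N × P') ≃ₗ[R] (N' × P)) := by
  have ha x : a (ι x) = ι' x := LinearMap.congr_fun ha x
  have hb x : b (ι' x) = ι x := LinearMap.congr_fun hb x
  -- Two shears of `P × P'` carry `ι K × 0` onto `0 × ι' K`.
  let f : P × P' →ₗ[R] N' × P :=
    { toFun := fun z => (π' (z.2 + a z.1), z.1 - b (z.2 + a z.1))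
      map_add' := fun x y => by
        ext <;> simp only [Prod.fst_add, Prod.snd_add, map_add] <;> abel
      map_smul' := fun r x => by
        ext <;> simp [smul_sub] }
  have hf : Function.Surjective f := by
    rintro ⟨n, p⟩
    obtain ⟨y, rfl⟩ := hπ' n
    refine ⟨(p + b y, y - a (p + b y)), Prod.ext ?_ ?_⟩
    · change π' (y - a (p + b y) + a (p + b y)) = π' y
      rw [sub_add_cancel]
    · change p + b y - b (y - a (p + b y) + a (p + b y)) = p
      rw [sub_add_cancel, add_sub_cancel_right]
  let g : P × P' →ₗ[R] N × P' := π.prodMap .id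
  have hg : Function.Surjective g := hπ.prodMap Function.surjective_id
  have hfg : LinearMap.ker g = LinearMap.ker f := by
    ext ⟨x, y⟩
    constructor
    · intro hxy
      have h1 : π x = 0 := congrArg Prod.fst hxy
      have h2 : y = 0 := congrArg Prod.snd hxy
      obtain ⟨k, rfl⟩ := (h x).1 h1
      subst h2
      refine Prod.ext ?_ ?_
      · change π' (0 + a (ι k)) = 0
        rw [zero_add, ha, h'.apply_apply_eq_zero]
      · change ι k - b (0 + a (ι k)) = 0
        rw [zero_add, ha, hb, sub_self]
    · intro hxy
      have h1 : π' (y + a x) = 0 := congrArg Prod.fst hxy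
      have h2 : x - b (y + a x) = 0 := congrArg Prod.snd hxy
      obtain ⟨k, hk⟩ := (h' _).1 h1
      rw [← hk, hb, sub_eq_zero] at h2
      subst h2
      rw [ha, right_eq_add] at hk
      exact Prod.ext (h.apply_apply_eq_zero k) hk
  exact ⟨(g.quotKerEquivOfSurjective hg).symm.trans
    ((Submodule.quotEquivOfEq _ _ hfg).trans (f.quotKerEquivOfSurjective hf))⟩

end Schanuel

/-! ### Sequences of cosyzygies -/

variable (A) in
/-- `Z'` is a cosyzygy of `Z`: there is a short exact sequence `0 → Z → P → Z' → 0` with `P`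
finitely generated projective which stays exact under `Hom_A(-, A)`. Splicing such sequences gives
the complexes in the definition of Gorenstein-projective modules. -/
def IsCosyzygy (Z Z' : Type u) [AddCommGroup Z] [Module Aᵐᵒᵖ Z] [AddCommGroup Z'] [Module Aᵐᵒᵖ Z'] :
    Prop :=
  ∃ (P : Type u) (_ : AddCommGroup P) (_ : Module Aᵐᵒᵖ P) (ι : Z →ₗ[Aᵐᵒᵖ] P)
    (π : P →ₗ[Aᵐᵒᵖ] Z'), Module.Finite Aᵐᵒᵖ P ∧ Module.Projective Aᵐᵒᵖ P ∧
    Function.Injective ι ∧ Function.Exact ι π ∧ Function.Surjective π ∧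
    ∀ f : Z →ₗ[Aᵐᵒᵖ] A, ∃ g : P →ₗ[Aᵐᵒᵖ] A, g ∘ₗ ι = f

variable (A) in
/-- `W` is a doubly infinite sequence of modules in which each is a cosyzygy of the one before. -/
def IsCosyzygyChain (W : ℤ → ModuleCat.{u} Aᵐᵒᵖ) : Prop :=
  ∀ n, IsCosyzygy A (W n) (W (n + 1))

theorem IsCosyzygyChain.isGorensteinProjective {W : ℤ → ModuleCat.{u} Aᵐᵒᵖ}
    (h : IsCosyzygyChain A W) : IsGorensteinProjective A (W 0) := by
  choose P i1 i2 ι π hfin hproj hι hex hπ hext using h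
  refine ⟨P, i1, i2, fun n => ι (n + 1) ∘ₗ π n, hfin, hproj, fun n => ?_, fun n => ?_, ⟨?_⟩⟩
  · intro x
    constructor
    · intro hx
      have hx : ι (n + 1 + 1) (π (n + 1) x) = 0 := hx
      rw [map_eq_zero_iff _ (hι _)] at hx
      obtain ⟨z, rfl⟩ := (hex _ _).1 hx
      obtain ⟨y, rfl⟩ := hπ n z
      exact ⟨y, rfl⟩
    · rintro ⟨y, rfl⟩
      change ι (n + 1 + 1) (π (n + 1) (ι (n + 1) (π n y))) = 0
      rw [(hex (n + 1)).apply_apply_eq_zero, map_zero]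
  · intro f
    constructor
    · intro hf
      have hf1 : ∀ z, f (ι (n + 1) z) = 0 := by
        intro z
        obtain ⟨y, rfl⟩ := hπ n z
        exact LinearMap.congr_fun hf y
      have hker : LinearMap.ker (π (n + 1)) ≤ LinearMap.ker f := by
        intro x hx
        obtain ⟨z, rfl⟩ := (hex _ _).1 hx
        exact hf1 z
      obtain ⟨g, hg⟩ := exists_factor (hπ _) f hker
      obtain ⟨h, hh⟩ := hext _ g
      refine ⟨h, LinearMap.ext fun x => ?_⟩
      exact (LinearMap.congr_fun hh _).trans (LinearMap.congr_fun hg x)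
    · rintro ⟨g, rfl⟩
      refine LinearMap.ext fun x => ?_
      change g (ι (n + 1 + 1) (π (n + 1) (ι (n + 1) (π n x)))) = 0
      rw [(hex (n + 1)).apply_apply_eq_zero, map_zero, map_zero]
  · refine (LinearEquiv.ofInjective (ι 0) (hι 0)).trans (LinearEquiv.ofEq _ _ ?_)
    exact (LinearMap.range_comp_of_range_eq_top (ι 0) (LinearMap.range_eq_top.2 (hπ (-1)))).symm

/-- A module is Gorenstein-projective as soon as it lies in a class of modules that contains with
every module a cosyzygy of it, and a module of which it is a cosyzygy. -/
theorem isGorensteinProjective_of_class {X : ModuleCat.{u} Aᵐᵒᵖ → Prop}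
    (hnext : ∀ Z, X Z → ∃ Z', X Z' ∧ IsCosyzygy A Z Z')
    (hprev : ∀ Z, X Z → ∃ Z', X Z' ∧ IsCosyzygy A Z' Z) {Z : ModuleCat.{u} Aᵐᵒᵖ} (hZ : X Z) :
    IsGorensteinProjective A Z := by
  choose next hn1 hn2 using hnext
  choose prev hp1 hp2 using hprev
  let Zp : ℕ → {Z // X Z} := fun n => Nat.rec ⟨Z, hZ⟩ (fun _ Y => ⟨next Y.1 Y.2, hn1 _ _⟩) n
  let Zm : ℕ → {Z // X Z} := fun n => Nat.rec ⟨Z, hZ⟩ (fun _ Y => ⟨prev Y.1 Y.2, hp1 _ _⟩) n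
  let W : ℤ → ModuleCat.{u} Aᵐᵒᵖ := fun n =>
    match n with
    | Int.ofNat n => (Zp n).1
    | Int.negSucc n => (Zm (n + 1)).1
  have hW : IsCosyzygyChain A W := by
    intro n
    match n with
    | Int.ofNat n => exact hn2 _ _
    | Int.negSucc 0 => exact hp2 _ _
    | Int.negSucc (n + 1) => exact hp2 _ _
  exact hW.isGorensteinProjective

theorem IsGorensteinProjective.exists_chain {N : Type w} [AddCommGroup N] [Module Aᵐᵒᵖ N]
    (h : IsGorensteinProjective A N) :
    ∃ W, IsCosyzygyChain A W ∧ ∃ m, Nonempty (N ≃ₗ[Aᵐᵒᵖ] W m) := by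
  obtain ⟨P, i1, i2, d, hfin, hproj, hex, hdual, ⟨e⟩⟩ := h
  let W : ℤ → ModuleCat.{u} Aᵐᵒᵖ := fun n => ModuleCat.of Aᵐᵒᵖ (LinearMap.range (d n))
  have hW (n) : IsCosyzygy A (W n) (W (n + 1)) := by
    refine ⟨P (n + 1), _, _, (LinearMap.range (d n)).subtype, (d (n + 1)).rangeRestrict,
      hfin _, hproj _, Subtype.val_injective, ?_, LinearMap.surjective_rangeRestrict _, fun f => ?_⟩
    · intro x
      have : (d (n + 1)).rangeRestrict x = 0 ↔ d (n + 1) x = 0 := Subtype.ext_iff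
      erw [this, hex n x]
      constructor
      · rintro ⟨y, rfl⟩; exact ⟨⟨_, y, rfl⟩, rfl⟩
      · rintro ⟨⟨_, y, rfl⟩, rfl⟩; exact ⟨y, rfl⟩
    · obtain ⟨m, rfl⟩ : ∃ m, n = m + 1 := ⟨n - 1, by ring⟩
      obtain ⟨g, hg⟩ := (hdual m (f ∘ₗ (d (m + 1)).rangeRestrict)).1 (by
        refine LinearMap.ext fun x => ?_
        have : (d (m + 1)).rangeRestrict (d m x) = 0 := Subtype.ext ((hex m).apply_apply_eq_zero x)
        change f ((d (m + 1)).rangeRestrict (d m x)) = 0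
        rw [this, map_zero])
      refine ⟨g, LinearMap.ext fun y => ?_⟩
      obtain ⟨y, rfl⟩ := LinearMap.surjective_rangeRestrict _ y
      exact LinearMap.congr_fun hg y
  exact ⟨W, hW, -1, ⟨e⟩⟩

theorem IsCosyzygy.congr {Z Z' Y Y' : Type u} [AddCommGroup Z] [Module Aᵐᵒᵖ Z] [AddCommGroup Z']
    [Module Aᵐᵒᵖ Z'] [AddCommGroup Y] [Module Aᵐᵒᵖ Y] [AddCommGroup Y'] [Module Aᵐᵒᵖ Y']
    (h : IsCosyzygy A Z Z') (e : Z ≃ₗ[Aᵐᵒᵖ] Y) (e' : Z' ≃ₗ[Aᵐᵒᵖ] Y') : IsCosyzygy A Y Y' := by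
  obtain ⟨P, _, _, ι, π, hfin, hproj, hι, hex, hπ, hext⟩ := h
  refine ⟨P, _, _, ι ∘ₗ e.symm.toLinearMap, e'.toLinearMap ∘ₗ π, hfin, hproj,
    hι.comp e.symm.injective, ?_, e'.surjective.comp hπ, fun f => ?_⟩
  · intro x
    change e' (π x) = 0 ↔ _
    rw [e'.map_eq_zero_iff, hex x]
    exact ⟨fun ⟨z, hz⟩ => ⟨e z, by simpa using hz⟩, fun ⟨y, hy⟩ => ⟨e.symm y, hy⟩⟩
  · obtain ⟨g, hg⟩ := hext (f ∘ₗ e.toLinearMap)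
    refine ⟨g, LinearMap.ext fun y => ?_⟩
    simpa using LinearMap.congr_fun hg (e.symm y)

/-! ### Syzygies and direct summands of Gorenstein-projective modules -/

/-- If `0 → K → P → N → 0` is exact with `P` projective and all maps `K → A` extend to `P`, that is,
`Ext¹(N, A) = 0`, then all maps `K' → A` extend to `P'`, for every exact sequence
`0 → K' → P' → N → 0`. -/
theorem exists_extend_of_exists_extend {K P N K' P' : Type*} [AddCommGroup K] [Module Aᵐᵒᵖ K]
    [AddCommGroup P] [Module Aᵐᵒᵖ P] [AddCommGroup N] [Module Aᵐᵒᵖ N]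
    [AddCommGroup K'] [Module Aᵐᵒᵖ K'] [AddCommGroup P'] [Module Aᵐᵒᵖ P']
    [Module.Projective Aᵐᵒᵖ P]
    {ι : K →ₗ[Aᵐᵒᵖ] P} {π : P →ₗ[Aᵐᵒᵖ] N} {ι' : K' →ₗ[Aᵐᵒᵖ] P'} {π' : P' →ₗ[Aᵐᵒᵖ] N}
    (hex : Function.Exact ι π) (hπ : Function.Surjective π)
    (hι' : Function.Injective ι') (hex' : Function.Exact ι' π') (hπ' : Function.Surjective π')
    (hext : ∀ f : K →ₗ[Aᵐᵒᵖ] A, ∃ g : P →ₗ[Aᵐᵒᵖ] A, g ∘ₗ ι = f) (f : K' →ₗ[Aᵐᵒᵖ] A) :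
    ∃ g : P' →ₗ[Aᵐᵒᵖ] A, g ∘ₗ ι' = f := by
  obtain ⟨a, ha⟩ := Module.projective_lifting_property π' π hπ'
  have ha x : π' (a x) = π x := LinearMap.congr_fun ha x
  -- the map `φ : K → K'` induced by `a`
  let e := LinearEquiv.ofInjective ι' hι'
  have he z : ι' (e.symm z) = z := congrArg Subtype.val (e.apply_symm_apply z)
  let φ : K →ₗ[Aᵐᵒᵖ] K' := e.symm.toLinearMap ∘ₗ
    (a ∘ₗ ι).codRestrict (LinearMap.range ι') fun x => (hex' _).1 (by
      change π' (a (ι x)) = 0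
      rw [ha, hex.apply_apply_eq_zero])
  have hφ x : ι' (φ x) = a (ι x) := he _
  obtain ⟨h, hh⟩ := hext (f ∘ₗ φ)
  have hh x : h (ι x) = f (φ x) := LinearMap.congr_fun hh x
  -- `P'` is a quotient of `P × K'`
  let q : P × K' →ₗ[Aᵐᵒᵖ] P' := a.coprod ι'
  have hqd x : q x = a x.1 + ι' x.2 := rfl
  have hq : Function.Surjective q := by
    intro y
    obtain ⟨x, hx⟩ := hπ (π' y)
    obtain ⟨z, hz⟩ := (hex' (y - a x)).1 (by rw [map_sub, ha, hx, sub_self])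
    exact ⟨(x, z), by rw [hqd, hz, add_sub_cancel]⟩
  have hker : LinearMap.ker q ≤ LinearMap.ker (h.coprod f) := by
    rintro ⟨x, z⟩ hxz
    have hxz : a x + ι' z = 0 := hxz
    obtain ⟨k, rfl⟩ := (hex x).1 (by
      rw [← ha, eq_neg_of_add_eq_zero_left hxz, map_neg, hex'.apply_apply_eq_zero, neg_zero])
    rw [← hφ, ← map_add, map_eq_zero_iff ι' hι'] at hxz
    change h (ι k) + f z = 0
    rw [hh, ← map_add, hxz, map_zero]
  obtain ⟨g, hg⟩ := exists_factor hq _ hker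
  refine ⟨g, LinearMap.ext fun z => ?_⟩
  have := LinearMap.congr_fun hg (0, z)
  simpa [q] using this

variable (A) in
/-- `p` is a direct summand of `W m × P`, where `W m` is a term of a sequence as in
`IsCosyzygyChain` and `P` is finitely generated projective. Unlike the terms of such sequences,
these modules are visibly closed under direct summands; the factor `P` absorbs the projective
modules that Schanuel's lemma introduces. -/
def IsChainSummand (p : ModuleCat.{u} Aᵐᵒᵖ) : Prop :=
  ∃ (q P : ModuleCat.{u} Aᵐᵒᵖ) (W : ℤ → ModuleCat.{u} Aᵐᵒᵖ) (m : ℤ), Module.Finite Aᵐᵒᵖ P ∧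
    Module.Projective Aᵐᵒᵖ P ∧ IsCosyzygyChain A W ∧ Nonempty ((p × q) ≃ₗ[Aᵐᵒᵖ] (W m × P))

theorem IsCosyzygy.finite_right {Z Z' : Type u} [AddCommGroup Z] [Module Aᵐᵒᵖ Z] [AddCommGroup Z']
    [Module Aᵐᵒᵖ Z'] (h : IsCosyzygy A Z Z') : Module.Finite Aᵐᵒᵖ Z' := by
  obtain ⟨P, _, _, ι, π, hfin, hproj, hι, hex, hπ, hext⟩ := h
  exact Module.Finite.of_surjective π hπ

section Prod

variable {Z Z' Q : Type u} [AddCommGroup Z] [Module Aᵐᵒᵖ Z] [AddCommGroup Z'] [Module Aᵐᵒᵖ Z']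
  [AddCommGroup Q] [Module Aᵐᵒᵖ Q] [Module.Finite Aᵐᵒᵖ Q] [Module.Projective Aᵐᵒᵖ Q]

variable (Q) in
theorem IsCosyzygy.prod_left (h : IsCosyzygy A Z Z') : IsCosyzygy A (Z × Q) Z' := by
  obtain ⟨P, _, _, ι, π, hfin, hproj, hι, hex, hπ, hext⟩ := h
  refine ⟨P × Q, _, _, ι.prodMap .id, π ∘ₗ .fst _ _ _, inferInstance, inferInstance,
    hι.prodMap Function.injective_id, ?_, hπ.comp Prod.fst_surjective, fun f => ?_⟩
  · rintro ⟨x, y⟩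
    refine (hex x).trans ⟨?_, ?_⟩
    · rintro ⟨z, rfl⟩; exact ⟨(z, y), rfl⟩
    · rintro ⟨⟨z, y⟩, h⟩; exact ⟨z, congrArg Prod.fst h⟩
  · obtain ⟨g, hg⟩ := hext (f ∘ₗ .inl _ _ _)
    refine ⟨g.coprod (f ∘ₗ .inr _ _ _), LinearMap.prod_ext ?_ ?_⟩
    · refine LinearMap.ext fun z => ?_
      simpa [Prod.mk_zero_zero] using LinearMap.congr_fun hg z
    · refine LinearMap.ext fun z => ?_
      simp

variable (Q) in
theorem IsCosyzygy.prod_right (h : IsCosyzygy A Z Z') : IsCosyzygy A Z (Z' × Q) := by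
  obtain ⟨P, _, _, ι, π, hfin, hproj, hι, hex, hπ, hext⟩ := h
  refine ⟨P × Q, _, _, .inl _ _ _ ∘ₗ ι, π.prodMap .id, inferInstance, inferInstance,
    LinearMap.inl_injective.comp hι, ?_, hπ.prodMap Function.surjective_id, fun f => ?_⟩
  · rintro ⟨x, y⟩
    constructor
    · intro h
      obtain ⟨z, rfl⟩ := (hex x).1 (congrArg Prod.fst h)
      have : y = 0 := congrArg Prod.snd h
      exact ⟨z, by rw [this]; rfl⟩
    · rintro ⟨z, h⟩
      obtain rfl : ι z = x := congrArg Prod.fst h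
      obtain rfl : 0 = y := congrArg Prod.snd h
      exact Prod.ext (hex.apply_apply_eq_zero z) rfl
  · obtain ⟨g, hg⟩ := hext f
    exact ⟨g ∘ₗ .fst _ _ _, hg⟩

end Prod

/-- The direct sum of `p` and its complement has a cosyzygy, and is one, in a sequence as in
`IsCosyzygyChain`. -/
theorem IsChainSummand.exists_isCosyzygy {p : ModuleCat.{u} Aᵐᵒᵖ} (h : IsChainSummand A p) :
    ∃ q : ModuleCat.{u} Aᵐᵒᵖ, Module.Finite Aᵐᵒᵖ (p × q) ∧
      (∃ W m, IsCosyzygyChain A W ∧ IsCosyzygy A (p × q) (W m)) ∧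
      ∃ W m, IsCosyzygyChain A W ∧ IsCosyzygy A (W m) (p × q) := by
  obtain ⟨q, P, W, m, _, _, hW, ⟨e⟩⟩ := h
  obtain ⟨m, rfl⟩ : ∃ n, m = n + 1 := ⟨m - 1, by ring⟩
  have h2 : IsCosyzygy A (W m) (p × q) := ((hW m).prod_right P).congr (.refl _ _) e.symm
  exact ⟨q, h2.finite_right, ⟨W, _, hW, ((hW (m + 1)).prod_left P).congr e.symm (.refl _ _)⟩,
    W, m, hW, h2⟩

theorem IsChainSummand.finite {p : ModuleCat.{u} Aᵐᵒᵖ} (h : IsChainSummand A p) :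
    Module.Finite Aᵐᵒᵖ p := by
  obtain ⟨q, _, -⟩ := h.exists_isCosyzygy
  exact Module.Finite.of_surjective (LinearMap.fst Aᵐᵒᵖ p q) Prod.fst_surjective

/-- If `0 → p × q → P → W m → 0` is exact, then by Schanuel's lemma the cokernels of `p → P` and
`q → P` are, up to projective modules, complementary summands of `W m`. -/
theorem IsChainSummand.exists_next {p : ModuleCat.{u} Aᵐᵒᵖ} (h : IsChainSummand A p) :
    ∃ p', IsChainSummand A p' ∧ IsCosyzygy A p p' := by
  obtain ⟨q, -, ⟨W, m, hW, P, _, _, ι, π, _, _, hι, hex, hπ, hext⟩, -⟩ := h.exists_isCosyzygy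
  let ιp : p →ₗ[Aᵐᵒᵖ] P := ι ∘ₗ .inl _ _ _
  let ιq : q →ₗ[Aᵐᵒᵖ] P := ι ∘ₗ .inr _ _ _
  have hextp (f : p →ₗ[Aᵐᵒᵖ] A) : ∃ g : P →ₗ[Aᵐᵒᵖ] A, g ∘ₗ ιp = f := by
    obtain ⟨g, hg⟩ := hext (f ∘ₗ .fst _ _ _)
    exact ⟨g, LinearMap.ext fun x => LinearMap.congr_fun hg (x, 0)⟩
  have hextq (f : q →ₗ[Aᵐᵒᵖ] A) : ∃ g : P →ₗ[Aᵐᵒᵖ] A, g ∘ₗ ιq = f := by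
    obtain ⟨g, hg⟩ := hext (f ∘ₗ .snd _ _ _)
    exact ⟨g, LinearMap.ext fun x => LinearMap.congr_fun hg (0, x)⟩
  let Cp := P ⧸ LinearMap.range ιp
  let Cq := P ⧸ LinearMap.range ιq
  let π' : P × P →ₗ[Aᵐᵒᵖ] Cp × Cq := (Submodule.mkQ _).prodMap (Submodule.mkQ _)
  have hπ' : Function.Surjective π' :=
    (Submodule.mkQ_surjective _).prodMap (Submodule.mkQ_surjective _)
  have hp : Function.Exact ιp (LinearMap.range ιp).mkQ := LinearMap.exact_map_mkQ_range ιp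
  have hq : Function.Exact ιq (LinearMap.range ιq).mkQ := LinearMap.exact_map_mkQ_range ιq
  have hex' : Function.Exact (ιp.prodMap ιq) π' := by
    rintro ⟨x, y⟩
    constructor
    · intro h
      obtain ⟨z, rfl⟩ := (hp x).1 (congrArg Prod.fst h)
      obtain ⟨w, rfl⟩ := (hq y).1 (congrArg Prod.snd h)
      exact ⟨(z, w), rfl⟩
    · rintro ⟨⟨z, w⟩, h⟩
      obtain rfl : ιp z = x := congrArg Prod.fst h
      obtain rfl : ιq w = y := congrArg Prod.snd h
      exact Prod.ext (hp.apply_apply_eq_zero z) (hq.apply_apply_eq_zero w)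
  obtain ⟨a, ha⟩ := exists_extend hext (ιp.prodMap ιq)
  obtain ⟨b, hb⟩ := exists_extend (ι := ιp.prodMap ιq) (Q := P) (fun f => by
    obtain ⟨g, hg⟩ := hextp (f ∘ₗ .inl _ _ _)
    obtain ⟨g', hg'⟩ := hextq (f ∘ₗ .inr _ _ _)
    refine ⟨g.coprod g', LinearMap.prod_ext ?_ ?_⟩
    · refine LinearMap.ext fun z => ?_
      simpa using LinearMap.congr_fun hg z
    · refine LinearMap.ext fun z => ?_
      simpa using LinearMap.congr_fun hg' z) ι
  obtain ⟨e⟩ := schanuel_dual hex hπ hex' hπ' ha hb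
  refine ⟨ModuleCat.of _ Cp, ⟨ModuleCat.of _ (Cq × P), ModuleCat.of _ (P × P), W, m,
    inferInstanceAs (Module.Finite Aᵐᵒᵖ (P × P)), inferInstanceAs (Module.Projective Aᵐᵒᵖ (P × P)),
    hW, ⟨(LinearEquiv.prodAssoc Aᵐᵒᵖ Cp Cq P).symm.trans e.symm⟩⟩, P, _, _, ιp, Submodule.mkQ _,
    inferInstance, inferInstance, hι.comp LinearMap.inl_injective, hp, Submodule.mkQ_surjective _,
    hextp⟩

/-- By Schanuel's lemma, the sum of syzygies of `p` and of its complement agrees, up to projective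
modules, with the preceding term of the sequence. -/
theorem IsChainSummand.ker {p : ModuleCat.{u} Aᵐᵒᵖ} (h : IsChainSummand A p) {Pp : Type u}
    [AddCommGroup Pp] [Module Aᵐᵒᵖ Pp] [Module.Finite Aᵐᵒᵖ Pp] [Module.Projective Aᵐᵒᵖ Pp]
    (πp : Pp →ₗ[Aᵐᵒᵖ] p) (hπp : Function.Surjective πp) :
    IsChainSummand A (ModuleCat.of _ (LinearMap.ker πp)) ∧ IsCosyzygy A (LinearMap.ker πp) p := by
  obtain ⟨q, hfin, -, W, m, hW, P, _, _, ι, π, _, _, hι, hex, hπ, hext⟩ := h.exists_isCosyzygy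
  have : Module.Finite Aᵐᵒᵖ q :=
    Module.Finite.of_surjective (LinearMap.snd Aᵐᵒᵖ p q) Prod.snd_surjective
  obtain ⟨n, πq, hπq⟩ := exists_free_cover (A := A) q
  let Kp := LinearMap.ker πp
  let Kq := LinearMap.ker πq
  let ι' : Kp × Kq →ₗ[Aᵐᵒᵖ] Pp × (Fin n → A) := Kp.subtype.prodMap Kq.subtype
  let π' : Pp × (Fin n → A) →ₗ[Aᵐᵒᵖ] p × q := πp.prodMap πq
  have hπ' : Function.Surjective π' := hπp.prodMap hπq
  have hι' : Function.Injective ι' := Subtype.val_injective.prodMap Subtype.val_injective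
  have hex' : Function.Exact ι' π' := by
    rintro ⟨x, y⟩
    constructor
    · intro h
      exact ⟨(⟨x, congrArg Prod.fst h⟩, ⟨y, congrArg Prod.snd h⟩), rfl⟩
    · rintro ⟨⟨z, w⟩, h⟩
      obtain rfl : z = x := congrArg Prod.fst h
      obtain rfl : w = y := congrArg Prod.snd h
      exact Prod.ext z.2 w.2
  obtain ⟨a, ha⟩ := Module.projective_lifting_property π' π hπ'
  obtain ⟨b, hb⟩ := Module.projective_lifting_property π π' hπ
  obtain ⟨e⟩ := schanuel hι hex hι' hex' ha hb
  refine ⟨⟨ModuleCat.of _ (Kq × P), ModuleCat.of _ (Pp × (Fin n → A)), W, m,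
    inferInstanceAs (Module.Finite Aᵐᵒᵖ (Pp × (Fin n → A))),
    inferInstanceAs (Module.Projective Aᵐᵒᵖ (Pp × (Fin n → A))),
    hW, ⟨(LinearEquiv.prodAssoc Aᵐᵒᵖ Kp Kq P).symm.trans e.symm⟩⟩, Pp, _, _, Kp.subtype, πp,
    inferInstance, inferInstance, Subtype.val_injective, LinearMap.exact_subtype_ker_map _, hπp,
    fun f => ?_⟩
  -- `Kp` also is the kernel of `Pp × q → p × q`
  obtain ⟨g, hg⟩ := exists_extend_of_exists_extend (ι' := LinearMap.inl Aᵐᵒᵖ Pp q ∘ₗ Kp.subtype)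
    (π' := πp.prodMap (LinearMap.id : q →ₗ[Aᵐᵒᵖ] q)) hex hπ
    (LinearMap.inl_injective.comp Subtype.val_injective) (by
      rintro ⟨x, y⟩
      constructor
      · intro h
        obtain rfl : y = 0 := congrArg Prod.snd h
        exact ⟨⟨x, congrArg Prod.fst h⟩, rfl⟩
      · rintro ⟨z, h⟩
        obtain rfl : z = x := congrArg Prod.fst h
        obtain rfl : 0 = y := congrArg Prod.snd h
        exact Prod.ext z.2 rfl) (hπp.prodMap Function.surjective_id) hext f
  exact ⟨g ∘ₗ .inl _ _ _, hg⟩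

theorem IsChainSummand.isGorensteinProjective {p : ModuleCat.{u} Aᵐᵒᵖ} (h : IsChainSummand A p) :
    IsGorensteinProjective A p := by
  refine isGorensteinProjective_of_class (fun Z hZ => hZ.exists_next) (fun Z hZ => ?_) h
  have := hZ.finite
  obtain ⟨n, π, hπ⟩ := exists_free_cover (A := A) Z
  exact ⟨_, hZ.ker π hπ⟩

theorem IsGorensteinProjective.isChainSummand_of_prod {p q : Type u} [AddCommGroup p]
    [Module Aᵐᵒᵖ p] [AddCommGroup q] [Module Aᵐᵒᵖ q] (h : IsGorensteinProjective A (p × q)) :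
    IsChainSummand A (ModuleCat.of _ p) := by
  obtain ⟨W, hW, m, ⟨e⟩⟩ := h.exists_chain
  let e' : W m ≃ₗ[Aᵐᵒᵖ] W m × PUnit.{u + 1} :=
    (LinearEquiv.prodUnique (R := Aᵐᵒᵖ) (M := W m) (M₂ := PUnit.{u + 1})).symm
  refine ⟨ModuleCat.of _ q, ModuleCat.of _ PUnit.{u + 1}, W, m,
    inferInstanceAs (Module.Finite Aᵐᵒᵖ PUnit.{u + 1}),
    inferInstanceAs (Module.Projective Aᵐᵒᵖ PUnit.{u + 1}),
    hW, ⟨e.trans e'⟩⟩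

/-- Direct summands of Gorenstein-projective modules are Gorenstein-projective. -/
theorem IsGorensteinProjective.of_prod {p q : Type u} [AddCommGroup p]
    [Module Aᵐᵒᵖ p] [AddCommGroup q] [Module Aᵐᵒᵖ q] (h : IsGorensteinProjective A (p × q)) :
    IsGorensteinProjective A p :=
  h.isChainSummand_of_prod.isGorensteinProjective

/-- Syzygies of Gorenstein-projective modules are Gorenstein-projective. -/
theorem IsGorensteinProjective.ker {N P : Type u} [AddCommGroup N]
    [Module Aᵐᵒᵖ N] [AddCommGroup P] [Module Aᵐᵒᵖ P] [Module.Finite Aᵐᵒᵖ P]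
    [Module.Projective Aᵐᵒᵖ P] (h : IsGorensteinProjective A N) (π : P →ₗ[Aᵐᵒᵖ] N)
    (hπ : Function.Surjective π) : IsGorensteinProjective A (LinearMap.ker π) := by
  have h' : IsGorensteinProjective A (N × PUnit.{u + 1}) :=
    h.congr (LinearEquiv.prodUnique (R := Aᵐᵒᵖ) (M := N) (M₂ := PUnit.{u + 1})).symm
  exact (h'.isChainSummand_of_prod.ker π hπ).1.isGorensteinProjective

end GorensteinProjective
/-! ### Direct summands of powers of a module -/

section Retract

variable {R : Type*} [Ring R] {M N : Type*} [AddCommGroup M] [Module R M] [AddCommGroup N]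
  [Module R N]

variable (R M N) in
/-- `N` is (isomorphic to) a direct summand of a finite direct sum of copies of `M`. -/
def IsSummandOfPower : Prop :=
  ∃ (n : ℕ) (i : N →ₗ[R] (Fin n → M)) (r : (Fin n → M) →ₗ[R] N), r ∘ₗ i = .id

theorem IsSummandOfPower.of_retract (i : N →ₗ[R] M) (r : M →ₗ[R] N) (h : r ∘ₗ i = .id) :
    IsSummandOfPower R M N :=
  ⟨1, LinearMap.pi fun _ => i, r ∘ₗ LinearMap.proj 0, h⟩

theorem IsSummandOfPower.trans {L : Type*} [AddCommGroup L] [Module R L]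
    (h : IsSummandOfPower R M N) (i : L →ₗ[R] N) (r : N →ₗ[R] L) (hr : r ∘ₗ i = .id) :
    IsSummandOfPower R M L := by
  obtain ⟨n, i', r', h'⟩ := h
  refine ⟨n, i' ∘ₗ i, r ∘ₗ r', LinearMap.ext fun x => ?_⟩
  exact (congrArg r (LinearMap.congr_fun h' (i x))).trans (LinearMap.congr_fun hr x)

theorem IsSummandOfPower.pi {ι : Type*} [Finite ι] {N : ι → Type*} [∀ t, AddCommGroup (N t)]
    [∀ t, Module R (N t)] (h : ∀ t, IsSummandOfPower R M (N t)) :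
    IsSummandOfPower R M (∀ t, N t) := by
  choose n i r hr using h
  let e := (Finite.equivFin (Σ t, Fin (n t)))
  refine ⟨_, LinearMap.pi fun s => LinearMap.proj (e.symm s).2 ∘ₗ i (e.symm s).1 ∘ₗ
    LinearMap.proj _,
    LinearMap.pi fun t => r t ∘ₗ LinearMap.pi fun s => LinearMap.proj (e ⟨t, s⟩), ?_⟩
  refine LinearMap.ext fun x => funext fun t => ?_
  refine Eq.trans ?_ (LinearMap.congr_fun (hr t) (x t))
  refine congrArg (r t) (funext fun s => ?_)
  change i (e.symm (e ⟨t, s⟩)).1 (x (e.symm (e ⟨t, s⟩)).1) (e.symm (e ⟨t, s⟩)).2 = _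
  rw [e.symm_apply_apply]

theorem IsSummandOfPower.prod {N' : Type*} [AddCommGroup N'] [Module R N']
    (h : IsSummandOfPower R M N) (h' : IsSummandOfPower R M N') :
    IsSummandOfPower R M (N × N') := by
  obtain ⟨n, i, r, hr⟩ := h
  obtain ⟨n', i', r', hr'⟩ := h'
  have h2 : IsSummandOfPower R M ((Fin n → M) × (Fin n' → M)) :=
    ⟨n + n', ((LinearEquiv.sumArrowLequivProdArrow (Fin n) (Fin n') R M).symm.trans
      (LinearEquiv.funCongrLeft R M finSumFinEquiv.symm)).toLinearMap,
      ((LinearEquiv.sumArrowLequivProdArrow (Fin n) (Fin n') R M).symm.trans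
      (LinearEquiv.funCongrLeft R M finSumFinEquiv.symm)).symm.toLinearMap,
      LinearMap.ext fun x => LinearEquiv.symm_apply_apply _ x⟩
  refine h2.trans (i.prodMap i') (r.prodMap r') (LinearMap.ext fun x => Prod.ext ?_ ?_)
  · exact LinearMap.congr_fun hr x.1
  · exact LinearMap.congr_fun hr' x.2

end Retract

/-! ### Gorenstein-projective modules of finite projective dimension -/

section Lift

variable {R : Type*} [Ring R] {Z P Z' K Q Y : Type*}
  [AddCommGroup Z] [Module R Z] [AddCommGroup P] [Module R P] [AddCommGroup Z'] [Module R Z']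
  [AddCommGroup K] [Module R K] [AddCommGroup Q] [Module R Q] [AddCommGroup Y] [Module R Y]

/-- Maps `Z' → Y` lift along `Q → Y` if `Ext¹(Z', K) = 0` for the kernel `K` of `Q → Y`; the
vanishing of `Ext¹` is expressed with a presentation `0 → Z → P → Z' → 0`. -/
theorem exists_lift [Module.Projective R P] {ι : Z →ₗ[R] P} {π : P →ₗ[R] Z'} {κ : K →ₗ[R] Q}
    {ρ : Q →ₗ[R] Y} (hex : Function.Exact ι π) (hπ : Function.Surjective π)
    (hκ : Function.Injective κ) (hex' : Function.Exact κ ρ) (hρ : Function.Surjective ρ)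
    (hext : ∀ f : Z →ₗ[R] K, ∃ g : P →ₗ[R] K, g ∘ₗ ι = f) (f : Z' →ₗ[R] Y) :
    ∃ g : Z' →ₗ[R] Q, ρ ∘ₗ g = f := by
  obtain ⟨a, ha⟩ := Module.projective_lifting_property ρ (f ∘ₗ π) hρ
  have ha x : ρ (a x) = f (π x) := LinearMap.congr_fun ha x
  let e := LinearEquiv.ofInjective κ hκ
  have he z : κ (e.symm z) = z := congrArg Subtype.val (e.apply_symm_apply z)
  let φ : Z →ₗ[R] K := e.symm.toLinearMap ∘ₗ
    (a ∘ₗ ι).codRestrict (LinearMap.range κ) fun x => (hex' _).1 (by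
      change ρ (a (ι x)) = 0
      rw [ha, hex.apply_apply_eq_zero, map_zero])
  have hφ x : κ (φ x) = a (ι x) := he _
  obtain ⟨h, hh⟩ := hext φ
  have hh x : h (ι x) = φ x := LinearMap.congr_fun hh x
  -- the corrected lift `a - κ h` vanishes on `Z`
  have hker : LinearMap.ker π ≤ LinearMap.ker (a - κ ∘ₗ h) := by
    intro x hx
    obtain ⟨z, rfl⟩ := (hex x).1 hx
    change a (ι z) - κ (h (ι z)) = 0
    rw [hh, hφ, sub_self]
  obtain ⟨g, hg⟩ := exists_factor hπ _ hker
  refine ⟨g, LinearMap.ext fun z => ?_⟩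
  obtain ⟨x, rfl⟩ := hπ z
  change ρ ((g ∘ₗ π) x) = f (π x)
  rw [hg]
  change ρ (a x - κ (h x)) = f (π x)
  rw [map_sub, hex'.apply_apply_eq_zero, sub_zero, ha]

end Lift

/-- A Gorenstein-projective module of projective dimension at most two is projective. The projective
modules of the resolution are summands of powers of `S`, so that `Ext¹` of a Gorenstein-projective
module vanishes on them; hence it vanishes on `im d₁` and `π` splits. -/
theorem IsGorensteinProjective.projective_of_resolution {S : Type u} [Ring S]
    {Y : Type w} {Q₀ Q₁ Q₂ : Type w'} [AddCommGroup Y] [Module Sᵐᵒᵖ Y]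
    [AddCommGroup Q₀] [Module Sᵐᵒᵖ Q₀] [AddCommGroup Q₁] [Module Sᵐᵒᵖ Q₁]
    [AddCommGroup Q₂] [Module Sᵐᵒᵖ Q₂] (hY : IsGorensteinProjective S Y)
    {d₂ : Q₂ →ₗ[Sᵐᵒᵖ] Q₁} {d₁ : Q₁ →ₗ[Sᵐᵒᵖ] Q₀} {π : Q₀ →ₗ[Sᵐᵒᵖ] Y}
    (hd₂ : Function.Injective d₂) (h₁ : Function.Exact d₂ d₁) (h₀ : Function.Exact d₁ π)
    (hπ : Function.Surjective π)
    (hQ₀ : IsSummandOfPower Sᵐᵒᵖ S Q₀) (hQ₁ : IsSummandOfPower Sᵐᵒᵖ S Q₁)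
    (hQ₂ : IsSummandOfPower Sᵐᵒᵖ S Q₂) : Module.Projective Sᵐᵒᵖ Y := by
  obtain ⟨W, hW, m, ⟨e⟩⟩ := hY.exists_chain
  obtain ⟨m, rfl⟩ : ∃ n, m = n + 1 + 1 := ⟨m - 2, by ring⟩
  obtain ⟨P, _, _, ι, p, _, _, hι, hex, hp, hext⟩ := hW m
  obtain ⟨P', _, _, ι', p', _, _, hι', hex', hp', hext'⟩ := hW (m + 1)
  obtain ⟨n₀, i₀, r₀, hr₀⟩ := hQ₀
  obtain ⟨n₁, i₁, r₁, hr₁⟩ := hQ₁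
  obtain ⟨n₂, i₂, r₂, hr₂⟩ := hQ₂
  -- `Ext¹(Y, im d₁) = 0`: maps to `im d₁` lift to `Q₁`, and then extend.
  obtain ⟨s, hs⟩ := exists_lift (K := LinearMap.range d₁) (κ := (LinearMap.range d₁).subtype)
    hex' hp' Subtype.val_injective (fun x => by rw [h₀ x]; simp) hπ (fun f => by
      obtain ⟨g, hg⟩ := exists_lift hex hp hd₂ (ρ := d₁.rangeRestrict)
        (fun x => by rw [← h₁ x]; exact Subtype.ext_iff) d₁.surjective_rangeRestrict
        (exists_extend_of_retract hext i₂ r₂ hr₂) f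
      obtain ⟨h, hh⟩ := exists_extend_of_retract hext' i₁ r₁ hr₁ g
      refine ⟨d₁.rangeRestrict ∘ₗ h, ?_⟩
      rw [LinearMap.comp_assoc, hh, hg]) e.symm.toLinearMap
  have : Module.Projective Sᵐᵒᵖ Q₀ := Module.Projective.of_split i₀ r₀ hr₀
  refine Module.Projective.of_split (s ∘ₗ e.toLinearMap) π (LinearMap.ext fun y => ?_)
  exact (LinearMap.congr_fun hs (e y)).trans (e.symm_apply_apply y)

/-! ### Decomposition into indecomposable modules -/

section Decomposition

theorem IsIndecomposable.congr {R : Type u} {M : Type w} {N : Type w'} [Ring R] [AddCommGroup M]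
    [Module R M] [AddCommGroup N] [Module R N] (h : IsIndecomposable R M) (e : M ≃ₗ[R] N) :
    IsIndecomposable R N := by
  refine ⟨have := h.1; e.symm.toEquiv.nontrivial, fun p q hpq => ?_⟩
  have := h.2 _ _ (hpq.map (Submodule.orderIsoMapComap e.symm))
  simpa using this

/-- Direct sum decompositions of `M` in terms of idempotent endomorphisms. -/
theorem isIndecomposable_iff {R : Type u} {M : Type w} [Ring R] [AddCommGroup M] [Module R M] :
    IsIndecomposable R M ↔
      Nontrivial M ∧ ∀ f : M →ₗ[R] M, f ∘ₗ f = f → f = 0 ∨ f = .id := by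
  refine and_congr_right fun _ => ⟨fun h f hf => ?_, fun h p q hpq => ?_⟩
  · have hf' : IsIdempotentElem f := hf
    rcases h _ _ (LinearMap.IsIdempotentElem.isCompl hf') with h | h
    · exact .inl (LinearMap.range_eq_bot.1 h)
    · refine .inr (LinearMap.ext fun x => ?_)
      exact (LinearMap.ker_eq_bot.1 h) (LinearMap.congr_fun hf x)
  · let f : M →ₗ[R] M := p.subtype ∘ₗ p.projectionOnto q hpq
    have hf : f ∘ₗ f = f := by
      refine LinearMap.ext fun x => ?_
      simp [f]
    rcases h f hf with h | h
    · refine .inl ((Submodule.eq_bot_iff _).2 fun x hx => ?_)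
      have := LinearMap.congr_fun h x
      simpa [f, Submodule.projectionOnto_apply_left hpq ⟨x, hx⟩] using this
    · refine .inr ((Submodule.eq_bot_iff _).2 fun x hx => ?_)
      have := LinearMap.congr_fun h x
      rw [LinearMap.comp_apply, (p.projectionOnto_apply_eq_zero_iff hpq).2 hx, map_zero] at this
      exact this.symm

variable {A : Type u} [Ring A]

/-- Every non-projective indecomposable Gorenstein-projective module has a representative. -/
theorem exists_gVertex (G : Type w) [AddCommGroup G] [Module Aᵐᵒᵖ G]
    (hG : IsIndecomposable Aᵐᵒᵖ G) (hGp : IsGorensteinProjective A G)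
    (hGn : ¬ Module.Projective Aᵐᵒᵖ G) : ∃ v : GVertex A, Nonempty (v.Mod ≃ₗ[Aᵐᵒᵖ] G) := by
  have := hGp.finite
  obtain ⟨n, π, hπ⟩ := exists_free_cover (A := A) G
  let e := π.quotKerEquivOfSurjective hπ
  let K : NPGorensteinProjective A := ⟨⟨n, LinearMap.ker π⟩, hG.congr e.symm, hGp.congr e.symm,
    fun h => hGn (Module.Projective.of_equiv e)⟩
  obtain ⟨f⟩ : Nonempty (_ ≃ₗ[Aᵐᵒᵖ] _) := Quotient.mk_out K
  exact ⟨Quotient.mk _ K, ⟨f.trans e⟩⟩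

theorem GVertex.eq_of_equiv {v w : GVertex A} (e : v.Mod ≃ₗ[Aᵐᵒᵖ] w.Mod) : v = w := by
  rw [← Quotient.out_eq v, ← Quotient.out_eq w]
  exact Quotient.sound ⟨e⟩

/-- Every Gorenstein-projective module is a direct summand of a power of the generator, by
decomposition into indecomposable modules. -/
theorem IsGorensteinProjective.isSummandOfPower [IsArtinianRing Aᵐᵒᵖ] {N : Type u} [AddCommGroup N]
    [Module Aᵐᵒᵖ N] (hN : IsGorensteinProjective A N) :
    IsSummandOfPower Aᵐᵒᵖ (CMGenerator A) N := by
  induction h : Module.length Aᵐᵒᵖ N using WellFoundedLT.induction generalizing N with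
  | ind l ih =>
  subst h
  have := hN.finite
  rcases subsingleton_or_nontrivial N with _ | hnt
  · exact ⟨0, 0, 0, Subsingleton.elim _ _⟩
  by_cases hi : IsIndecomposable Aᵐᵒᵖ N
  · by_cases hp : Module.Projective Aᵐᵒᵖ N
    · obtain ⟨n, i, r, hr⟩ := exists_retract_free (A := A) N
      exact (IsSummandOfPower.pi fun _ => .of_retract (CMGenerator.inA A) (CMGenerator.prA A)
        rfl).trans i r hr
    · obtain ⟨v, ⟨e⟩⟩ := exists_gVertex N hi hN hp
      exact .trans (.of_retract (CMGenerator.inG v) (CMGenerator.prG v)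
        (LinearMap.ext (CMGenerator.prG_inG v))) e.symm.toLinearMap e.toLinearMap
          (LinearMap.ext e.apply_symm_apply)
  · obtain ⟨p, q, hpq, hp, hq⟩ : ∃ p q : Submodule Aᵐᵒᵖ N, IsCompl p q ∧ p ≠ ⊥ ∧ q ≠ ⊥ := by
      by_contra! h
      exact hi ⟨hnt, fun p q hpq => or_iff_not_imp_left.2 (h p q hpq)⟩
    have hp' : p ≠ ⊤ := fun h => hq (by simpa [h] using hpq.inf_eq_bot)
    have hq' : q ≠ ⊤ := fun h => hp (by simpa [h] using hpq.inf_eq_bot)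
    let e := Submodule.prodEquivOfIsCompl p q hpq
    have gp := (hN.congr e.symm).of_prod
    have gq := (hN.congr (e.symm.trans (LinearEquiv.prodComm ..))).of_prod
    exact ((ih _ (Submodule.length_lt hp') gp rfl).prod
      (ih _ (Submodule.length_lt hq') gq rfl)).trans e.symm.toLinearMap e.toLinearMap
      (LinearMap.ext e.apply_symm_apply)

end Decomposition

/-! ### The functor `Hom_A(M, -)` -/

section HomM

open CMGenerator

variable {A : Type u} [Ring A]

variable (A) in
/-- The right module `Hom_A(M, N)` over the Cohen-Macaulay-Auslander algebra `C = End_A(M)`, where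
`M` is the direct sum of the indecomposable Gorenstein-projective modules; `C` acts by
precomposition. -/
def HomM (N : Type w) [AddCommGroup N] [Module Aᵐᵒᵖ N] : Type (max u w) :=
  CMGenerator A →ₗ[Aᵐᵒᵖ] N

section

variable {N : Type w} [AddCommGroup N] [Module Aᵐᵒᵖ N]
  {L : Type w'} [AddCommGroup L] [Module Aᵐᵒᵖ L]

instance : AddCommGroup (HomM A N) := inferInstanceAs (AddCommGroup (CMGenerator A →ₗ[Aᵐᵒᵖ] N))

instance : FunLike (HomM A N) (CMGenerator A) N :=
  inferInstanceAs (FunLike (CMGenerator A →ₗ[Aᵐᵒᵖ] N) (CMGenerator A) N)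

instance : LinearMapClass (HomM A N) Aᵐᵒᵖ (CMGenerator A) N :=
  inferInstanceAs (LinearMapClass (CMGenerator A →ₗ[Aᵐᵒᵖ] N) Aᵐᵒᵖ (CMGenerator A) N)

instance : FunLike (CMAuslanderAlgebra A) (CMGenerator A) (CMGenerator A) :=
  inferInstanceAs (FunLike (CMGenerator A →ₗ[Aᵐᵒᵖ] CMGenerator A) (CMGenerator A) (CMGenerator A))

instance : LinearMapClass (CMAuslanderAlgebra A) Aᵐᵒᵖ (CMGenerator A) (CMGenerator A) :=
  inferInstanceAs (LinearMapClass (CMGenerator A →ₗ[Aᵐᵒᵖ] CMGenerator A) Aᵐᵒᵖ _ _)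

theorem HomM.ext {f g : HomM A N} (h : ∀ x, f x = g x) : f = g := LinearMap.ext h

theorem CMAuslanderAlgebra.ext {f g : CMAuslanderAlgebra A} (h : ∀ x, f x = g x) : f = g :=
  LinearMap.ext h

instance : Module (CMAuslanderAlgebra A)ᵐᵒᵖ (HomM A N) where
  smul c f := LinearMap.comp (M₂ := CMGenerator A) f (unop c)
  one_smul _ := rfl
  mul_smul _ _ _ := rfl
  smul_zero _ := rfl
  smul_add _ _ _ := rfl
  add_smul c d f := HomM.ext fun x => map_add f (unop c x) (unop d x)
  zero_smul f := HomM.ext fun _ => map_zero f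

/-- The functor `Hom_A(M, -)` on maps. -/
def HomM.map (φ : N →ₗ[Aᵐᵒᵖ] L) : HomM A N →ₗ[(CMAuslanderAlgebra A)ᵐᵒᵖ] HomM A L where
  toFun f := φ ∘ₗ (f : CMGenerator A →ₗ[Aᵐᵒᵖ] N)
  map_add' f g := HomM.ext fun x => map_add φ (f x) (g x)
  map_smul' _ _ := rfl

theorem HomM.map_apply (φ : N →ₗ[Aᵐᵒᵖ] L) (f : HomM A N) (x : CMGenerator A) :
    HomM.map φ f x = φ (f x) := rfl

/-- `Hom_A(M, N)` is projective over `End_A(M)` if `N` is a direct summand of a power of `M`. -/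
theorem HomM.isSummandOfPower (h : IsSummandOfPower Aᵐᵒᵖ (CMGenerator A) N) :
    IsSummandOfPower (CMAuslanderAlgebra A)ᵐᵒᵖ (CMAuslanderAlgebra A) (HomM A N) := by
  obtain ⟨n, i, r, hr⟩ := h
  let e : HomM A (Fin n → CMGenerator A) →ₗ[(CMAuslanderAlgebra A)ᵐᵒᵖ]
      (Fin n → CMAuslanderAlgebra A) :=
    { toFun := fun f t => LinearMap.proj t ∘ₗ (f : CMGenerator A →ₗ[Aᵐᵒᵖ] (Fin n → CMGenerator A))
      map_add' := fun _ _ => rfl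
      map_smul' := fun _ _ => rfl }
  let e' : (Fin n → CMAuslanderAlgebra A) →ₗ[(CMAuslanderAlgebra A)ᵐᵒᵖ]
      HomM A (Fin n → CMGenerator A) :=
    { toFun := fun f => LinearMap.pi (M₂ := CMGenerator A) (φ := fun _ => CMGenerator A) f
      map_add' := fun _ _ => rfl
      map_smul' := fun _ _ => rfl }
  exact ⟨n, e ∘ₗ HomM.map i, HomM.map r ∘ₗ e',
    LinearMap.ext fun f => HomM.ext fun x => LinearMap.congr_fun hr (f x)⟩

theorem HomM.map_injective {φ : N →ₗ[Aᵐᵒᵖ] L} (h : Function.Injective φ) :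
    Function.Injective (HomM.map φ) := fun _ _ hfg =>
  HomM.ext fun x => h (DFunLike.congr_fun hfg x)

theorem HomM.map_exact {K : Type w''} [AddCommGroup K] [Module Aᵐᵒᵖ K] {φ : K →ₗ[Aᵐᵒᵖ] N}
    {ψ : N →ₗ[Aᵐᵒᵖ] L} (h : Function.Exact φ ψ) (hφ : Function.Injective φ) :
    Function.Exact (HomM.map φ) (HomM.map ψ) := by
  intro f
  constructor
  · intro hf
    let e := LinearEquiv.ofInjective φ hφ
    refine ⟨e.symm.toLinearMap ∘ₗ LinearMap.codRestrict (LinearMap.range φ)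
      (f : CMGenerator A →ₗ[Aᵐᵒᵖ] N) fun x => (h _).1 (DFunLike.congr_fun hf x),
      HomM.ext fun x => ?_⟩
    exact congrArg Subtype.val (e.apply_symm_apply _)
  · rintro ⟨g, rfl⟩
    exact HomM.ext fun x => h.apply_apply_eq_zero (g x)

/-- The map `M → N`, `m ↦ x · pr(m)`, where `pr` is the projection of `M` onto `A`. -/
def HomM.ofMem (x : N) : HomM A N :=
  LinearMap.toSpanSingleton Aᵐᵒᵖ N x ∘ₗ (opEquiv A).toLinearMap ∘ₗ prA A

variable (N) in
/-- The restriction of `Hom_A(M, N)` to `A` is `Hom_A(A, N) = N`. -/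
def HomM.resEquiv : res (cornerHom A) (HomM A N) ≃ₗ[Aᵐᵒᵖ] N where
  toFun f := (f : HomM A N) (inA A 1)
  map_add' _ _ := rfl
  map_smul' a f := by
    change (f : HomM A N) (cornerHom A a.unop (inA A 1)) = a • (f : HomM A N) (inA A 1)
    have h : cornerHom A a.unop (inA A 1) = a • inA A 1 := by
      rw [← map_smul]
      change inA A (a.unop * 1) = inA A (1 * a.unop)
      rw [one_mul, mul_one]
    rw [h, map_smul]
  invFun x := ⟨HomM.ofMem x, HomM.ofMem x, HomM.ext fun m => by
    change op (1 * prA A m) • x = op (prA A m) • x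
    rw [one_mul]⟩
  left_inv := by
    rintro ⟨_, f, rfl⟩
    refine Subtype.ext (HomM.ext fun m => ?_)
    change op (prA A m) • f (cornerHom A 1 (inA A 1)) = f (cornerHom A 1 m)
    rw [← map_smul, ← map_smul]
    congr 1
    change inA A (1 * prA A (op (prA A m) • inA A 1)) = inA A (1 * prA A m)
    rw [one_mul, one_mul, map_smul]
    change inA A (1 * prA A m) = _
    rw [one_mul]
  right_inv x := by
    change op (1 : A) • x = x
    simp

end

section Res

variable {C : Type*} [Ring C] (j : A →ₙ+* C) {X Y : Type*} [AddCommGroup X] [Module Cᵐᵒᵖ X]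
  [AddCommGroup Y] [Module Cᵐᵒᵖ Y]

/-- Restriction as a functor. -/
def resMap (f : X →ₗ[Cᵐᵒᵖ] Y) : res j X →ₗ[Aᵐᵒᵖ] res j Y where
  toFun x := ⟨f x, by
    obtain ⟨_, y, rfl⟩ := x
    exact ⟨f y, (map_smul f _ _).symm⟩⟩
  map_add' x y := Subtype.ext (map_add f _ _)
  map_smul' a x := Subtype.ext (map_smul f _ _)

/-- Restriction as a functor, on isomorphisms. -/
def resCongr (e : X ≃ₗ[Cᵐᵒᵖ] Y) : res j X ≃ₗ[Aᵐᵒᵖ] res j Y :=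
  .ofLinearMap (resMap j e.toLinearMap) (resMap j e.symm.toLinearMap)
    (LinearMap.ext fun x => Subtype.ext (e.apply_symm_apply x))
    (LinearMap.ext fun x => Subtype.ext (e.symm_apply_apply x))

end Res

/-- The right ideal `e_v C` is `Hom_A(M, G_v)`. -/
def rightIdealVertexEquiv (v : GVertex A) :
    rightIdeal (vertexIdempotent v) ≃ₗ[(CMAuslanderAlgebra A)ᵐᵒᵖ] HomM A v.Mod where
  toFun c := LinearMap.comp (M₂ := CMGenerator A) (prG v) c.1
  map_add' c d := HomM.ext fun x => map_add (prG v) ((c : CMAuslanderAlgebra A) x) _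
  map_smul' _ _ := rfl
  invFun f := ⟨inG v ∘ₗ (f : CMGenerator A →ₗ[Aᵐᵒᵖ] v.Mod),
    inG v ∘ₗ (f : CMGenerator A →ₗ[Aᵐᵒᵖ] v.Mod),
    CMAuslanderAlgebra.ext fun x => congrArg (inG v) (prG_inG v (f x))⟩
  left_inv := by
    rintro ⟨_, c, rfl⟩
    exact Subtype.ext (CMAuslanderAlgebra.ext fun x => congrArg (inG v) (prG_inG v _))
  right_inv f := HomM.ext fun x => prG_inG v (f x)

/-- Idempotent endomorphisms of `Hom_A(M, N)` come from idempotent endomorphisms of `N`, if `N` is a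
direct summand of `M`. -/
theorem HomM.isIndecomposable {N : Type w} [AddCommGroup N] [Module Aᵐᵒᵖ N]
    (i : N →ₗ[Aᵐᵒᵖ] CMGenerator A) (r : CMGenerator A →ₗ[Aᵐᵒᵖ] N) (hr : ∀ x, r (i x) = x)
    (h : IsIndecomposable Aᵐᵒᵖ N) : IsIndecomposable (CMAuslanderAlgebra A)ᵐᵒᵖ (HomM A N) := by
  rw [isIndecomposable_iff] at h ⊢
  obtain ⟨hnt, h⟩ := h
  constructor
  · obtain ⟨x, hx⟩ := exists_ne (0 : N)
    refine ⟨⟨r, 0, fun h0 => hx ?_⟩⟩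
    rw [← hr x]
    exact DFunLike.congr_fun (F := HomM A N) h0 (i x)
  · intro t ht
    let τ : N →ₗ[Aᵐᵒᵖ] N := LinearMap.comp (M₂ := CMGenerator A) (t r : HomM A N) i
    -- Yoneda: `t` is composition with `τ`, as `f = r ∘ (i ∘ f)`
    have hτ (f : HomM A N) (x) : t f x = τ (f x) := by
      have : op (show CMAuslanderAlgebra A from i ∘ₗ (f : CMGenerator A →ₗ[Aᵐᵒᵖ] N)) •
          (show HomM A N from r) = f := HomM.ext fun x => hr (f x)
      conv_lhs => rw [← this, map_smul]
      rfl
    have hτr (x) : τ (r x) = t r x := (hτ r x).symm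
    rcases h τ (LinearMap.ext fun x => by
      change τ (t r (i x)) = t r (i x)
      rw [← hτ]
      exact DFunLike.congr_fun (LinearMap.congr_fun ht (show HomM A N from r)) _) with h | h
    · exact .inl (LinearMap.ext fun f => HomM.ext fun x => by rw [hτ, h]; rfl)
    · exact .inr (LinearMap.ext fun f => HomM.ext fun x => by rw [hτ, h]; rfl)

end HomM

/-! ### The induced module -/

section Ind

variable {A : Type u} {C : Type v} [Ring A] [Ring C] (j : A →ₙ+* C)
  {G : Type w} [AddCommGroup G] [Module Aᵐᵒᵖ G]

/-- The element `g ⊗ x` of `G ⊗_A εC`, as a function of `x`. -/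
def indMk (g : G) : rightIdeal (j 1) →ₗ[Cᵐᵒᵖ] ind j G where
  toFun x := Submodule.Quotient.mk (x ⊗ₜ[ℤ] g)
  map_add' x y := congrArg Submodule.Quotient.mk (TensorProduct.add_tmul x y g)
  map_smul' _ _ := rfl

theorem indMk_add (g g' : G) (x : rightIdeal (j 1)) :
    indMk j (g + g') x = indMk j g x + indMk j g' x :=
  congrArg Submodule.Quotient.mk (TensorProduct.tmul_add x g g')

theorem indMk_op_smul (a : A) (g : G) (x : rightIdeal (j 1)) :
    indMk j (op a • g) x = indMk j g (a • x) := by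
  refine ((Submodule.Quotient.eq _).2 (Submodule.subset_span ?_)).symm
  exact ⟨a, x, g, rfl⟩

theorem indMk_zero (x : rightIdeal (j 1)) : indMk j (0 : G) x = 0 :=
  congrArg Submodule.Quotient.mk (TensorProduct.tmul_zero _ x)

theorem indMk_sum {ι : Type*} (s : Finset ι) (g : ι → G) (x : rightIdeal (j 1)) :
    indMk j (∑ i ∈ s, g i) x = ∑ i ∈ s, indMk j (g i) x :=
  map_sum (⟨⟨fun g => indMk j g x, indMk_zero j x⟩, fun g g' => indMk_add j g g' x⟩ :
    G →+ ind j G) g s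

theorem ind_induction {p : ind j G → Prop} (h : ∀ g x, p (indMk j g x)) (h0 : p 0)
    (hadd : ∀ y z, p y → p z → p (y + z)) (y : ind j G) : p y := by
  obtain ⟨t, rfl⟩ := Submodule.Quotient.mk_surjective _ y
  induction t with
  | zero => exact h0
  | add x y hx hy => exact hadd _ _ hx hy
  | tmul x g => exact h g x

/-- Induction is left adjoint to restriction: the map `G ⊗_A εC → D`, `g ⊗ x ↦ s(g) x`. -/
theorem exists_indLift {D : Type w'} [AddCommGroup D] [Module Cᵐᵒᵖ D] (s : G →ₗ[Aᵐᵒᵖ] res j D) :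
    ∃ f : ind j G →ₗ[Cᵐᵒᵖ] D, ∀ g x, f (indMk j g x) = op (x : C) • (s g : D) := by
  let b : rightIdeal (j 1) →ₗ[Cᵐᵒᵖ] G →ₗ[ℤ] D :=
    { toFun := fun x => AddMonoidHom.toIntLinearMap
        { toFun := fun g => op (x : C) • (s g : D)
          map_zero' := by simp
          map_add' := fun g g' => by simp }
      map_add' := fun x y => LinearMap.ext fun g => add_smul (op (x : C)) (op (y : C)) (s g : D)
      map_smul' := fun c x => LinearMap.ext fun g => mul_smul c (op (x : C)) (s g : D) }
  refine ⟨Submodule.liftQ _ (TensorProduct.AlgebraTensorModule.lift b) (Submodule.span_le.2 ?_),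
    fun g x => rfl⟩
  rintro _ ⟨a, x, g, rfl⟩
  change TensorProduct.AlgebraTensorModule.lift b (_ - _) = 0
  rw [map_sub, TensorProduct.AlgebraTensorModule.lift_tmul,
    TensorProduct.AlgebraTensorModule.lift_tmul]
  change op (j a * (x : C)) • (s g : D) - op (x : C) • ((s (op a • g) : res j D) : D) = 0
  rw [map_smul, res_coe_smul, smul_smul, unop_op, ← op_mul, sub_self]

end Ind

/-! ### Presentation and restriction of the induced module -/

section IndCM

open CMGenerator

variable {A : Type u} [Ring A] {G : Type w} [AddCommGroup G] [Module Aᵐᵒᵖ G]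

/-- The identification of `Hom_A(M, A)` with the right ideal `εC`, by composition with the inclusion
`A → M`. -/
def toCorner : HomM A A →ₗ[(CMAuslanderAlgebra A)ᵐᵒᵖ] rightIdeal (cornerHom A 1) where
  toFun h := ⟨inA A ∘ₗ (h : CMGenerator A →ₗ[Aᵐᵒᵖ] A), inA A ∘ₗ (h : CMGenerator A →ₗ[Aᵐᵒᵖ] A),
    CMAuslanderAlgebra.ext fun x => congrArg (inA A) (one_mul (h x))⟩
  map_add' h h' := Subtype.ext (CMAuslanderAlgebra.ext fun x => map_add (inA A) (h x) (h' x))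
  map_smul' _ _ := rfl

theorem toCorner_surjective : Function.Surjective (toCorner (A := A)) := by
  rintro ⟨_, c, rfl⟩
  refine ⟨LinearMap.comp (M₂ := CMGenerator A) (prA A) c, ?_⟩
  refine Subtype.ext (CMAuslanderAlgebra.ext fun x => ?_)
  exact congrArg (inA A) (one_mul (prA A (c x))).symm

/-- The map `h ↦ (m ↦ x · h(m))`. -/
def HomM.mulLeft (x : G) : HomM A A →ₗ[(CMAuslanderAlgebra A)ᵐᵒᵖ] HomM A G :=
  HomM.map (LinearMap.toSpanSingleton Aᵐᵒᵖ G x ∘ₗ (opEquiv A).toLinearMap)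

theorem HomM.mulLeft_apply (x : G) (h : HomM A A) (m : CMGenerator A) :
    HomM.mulLeft x h m = op (h m) • x := rfl

theorem HomM.sum_apply {ι : Type*} (s : Finset ι) (f : ι → HomM A G) (m : CMGenerator A) :
    (∑ i ∈ s, f i) m = ∑ i ∈ s, f i m :=
  map_sum (⟨⟨fun f => f m, rfl⟩, fun _ _ => rfl⟩ : HomM A G →+ G) f s

theorem pi_eq_sum {n : ℕ} (a : Fin n → A) : a = ∑ i, op (a i) • (Pi.single i 1 : Fin n → A) := by
  ext t
  simp [Finset.sum_apply, Pi.single_apply]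

theorem HomM.eq_sum_mulLeft {n : ℕ} (f : HomM A (Fin n → A)) :
    f = ∑ i, HomM.mulLeft (Pi.single i 1) (HomM.map (LinearMap.proj i) f) := by
  refine HomM.ext fun m => ?_
  rw [HomM.sum_apply]
  exact pi_eq_sum (f m)

/-- The map `Hom_A(M, A ^ n) → G ⊗_A εC` which corresponds to `π ⊗ εC` under the isomorphism
`Hom_A(M, A ^ n) = A ^ n ⊗_A εC`. -/
def indCover {n : ℕ} (π : (Fin n → A) →ₗ[Aᵐᵒᵖ] G) :
    HomM A (Fin n → A) →ₗ[(CMAuslanderAlgebra A)ᵐᵒᵖ] ind (cornerHom A) G :=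
  ∑ i, indMk (cornerHom A) (π (Pi.single i 1)) ∘ₗ toCorner ∘ₗ HomM.map (LinearMap.proj i)

theorem indCover_mulLeft {n : ℕ} (π : (Fin n → A) →ₗ[Aᵐᵒᵖ] G) (a : Fin n → A) (h : HomM A A) :
    indCover π (HomM.mulLeft a h) = indMk (cornerHom A) (π a) (toCorner h) := by
  conv_rhs => rw [pi_eq_sum a, map_sum, indMk_sum]
  rw [indCover, LinearMap.sum_apply]
  refine Finset.sum_congr rfl fun i _ => ?_
  rw [map_smul, indMk_op_smul]
  rfl

theorem indCover_surjective {n : ℕ} {π : (Fin n → A) →ₗ[Aᵐᵒᵖ] G} (hπ : Function.Surjective π) :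
    Function.Surjective (indCover π) := by
  rw [← LinearMap.range_eq_top, eq_top_iff]
  rintro y -
  refine ind_induction _ (fun g x => ?_) (zero_mem _) (fun _ _ => add_mem) y
  obtain ⟨a, rfl⟩ := hπ g
  obtain ⟨h, rfl⟩ := toCorner_surjective x
  exact ⟨_, indCover_mulLeft π a h⟩

/-- `Hom_A(M, A ^ m) → Hom_A(M, A ^ n) → G ⊗_A εC → 0` is exact for a presentation
`A ^ m → A ^ n → G → 0` of `G`. -/
theorem indCover_exact {m n : ℕ} {d : (Fin m → A) →ₗ[Aᵐᵒᵖ] (Fin n → A)}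
    {π : (Fin n → A) →ₗ[Aᵐᵒᵖ] G} (hπ : Function.Surjective π) (h : Function.Exact d π) :
    Function.Exact (HomM.map d) (indCover π) := by
  -- the inverse of `Hom_A(M, A ^ n) / Hom_A(M, A ^ m) → G ⊗_A εC` comes from the adjunction
  let W := LinearMap.range (HomM.map d)
  obtain ⟨s, hs⟩ := exists_factor hπ
    (resMap (cornerHom A) W.mkQ ∘ₗ (HomM.resEquiv (Fin n → A)).symm.toLinearMap) (by
      intro x hx
      obtain ⟨b, rfl⟩ := (h x).1 hx
      refine Subtype.ext ((Submodule.Quotient.mk_eq_zero W).2 ⟨HomM.ofMem b, HomM.ext fun t => ?_⟩)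
      exact map_smul d _ b)
  obtain ⟨ψ, hψ⟩ := exists_indLift (cornerHom A) s
  have hψφ f : ψ (indCover π f) = W.mkQ f := by
    conv_lhs => rw [HomM.eq_sum_mulLeft f]
    conv_rhs => rw [HomM.eq_sum_mulLeft f]
    simp only [map_sum]
    refine Finset.sum_congr rfl fun i _ => ?_
    rw [indCover_mulLeft, hψ]
    have : (s (π (Pi.single i 1)) : HomM A (Fin n → A) ⧸ W) = W.mkQ (HomM.ofMem (Pi.single i 1)) :=
      congrArg Subtype.val (LinearMap.congr_fun hs (Pi.single i 1))
    rw [this, ← map_smul]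
    rfl
  intro f
  constructor
  · intro hf
    exact (Submodule.Quotient.mk_eq_zero W).1 (by rw [← Submodule.mkQ_apply, ← hψφ, hf, map_zero])
  · rintro ⟨f, rfl⟩
    rw [HomM.eq_sum_mulLeft f, map_sum, map_sum]
    refine Finset.sum_eq_zero fun i _ => ?_
    have : HomM.map d (HomM.mulLeft (Pi.single i 1) (HomM.map (LinearMap.proj i) f)) =
        HomM.mulLeft (d (Pi.single i 1)) (HomM.map (LinearMap.proj i) f) :=
      HomM.ext fun t => map_smul d _ _
    rw [this, indCover_mulLeft, h.apply_apply_eq_zero, indMk_zero]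

variable (G) in
/-- The restriction to `A` of the natural map `χ : G ⊗_A εC → Hom_A(M, G)` is an isomorphism `e`
onto `Hom_A(A, G) = G`, and `χ` carries `π ⊗ εC` to `Hom_A(M, π)`. -/
theorem exists_ind_to_homM : ∃ (χ : ind (cornerHom A) G →ₗ[(CMAuslanderAlgebra A)ᵐᵒᵖ] HomM A G)
    (e : res (cornerHom A) (ind (cornerHom A) G) ≃ₗ[Aᵐᵒᵖ] G),
    (∀ y, e y = HomM.resEquiv G (resMap (cornerHom A) χ y)) ∧
    ∀ (n : ℕ) (π : (Fin n → A) →ₗ[Aᵐᵒᵖ] G), χ ∘ₗ indCover π = HomM.map π := by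
  obtain ⟨χ, hχ⟩ := exists_indLift (cornerHom A) (HomM.resEquiv G).symm.toLinearMap
  have hχ' g x m : χ (indMk _ g x) m = op (prA A ((x : CMAuslanderAlgebra A) m)) • g := by
    rw [hχ]; rfl
  let ε : rightIdeal (cornerHom A 1) := ⟨cornerHom A 1, 1, mul_one _⟩
  have hε g : indMk (cornerHom A) g ε ∈ res (cornerHom A) (ind (cornerHom A) G) :=
    ⟨indMk _ g ε, by
      change op (cornerHom A 1) • indMk _ g ε = _
      rw [← map_smul]
      exact congrArg (indMk _ g) (Subtype.ext (map_mul_map_one (cornerHom A) 1))⟩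
  have hsurj (y : ind (cornerHom A) G) :
      ∃ g, op (cornerHom A 1) • y = indMk (cornerHom A) g ε := by
    refine ind_induction (cornerHom A)
      (p := fun y => ∃ g, op (cornerHom A 1) • y = indMk (cornerHom A) g ε)
      (fun g x => ?_) ⟨0, by rw [smul_zero, indMk_zero]⟩ ?_ y
    · obtain ⟨_, c, rfl⟩ := x
      obtain ⟨a, ha⟩ : epsStar A * c * epsStar A ∈ Set.range (cornerHom A) := by
        rw [range_cornerHom]; exact ⟨c, rfl⟩
      refine ⟨op a • g, ?_⟩
      rw [indMk_op_smul, ← map_smul]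
      refine congrArg (indMk _ g) (Subtype.ext ?_)
      change cornerHom A 1 * c * cornerHom A 1 = cornerHom A a * cornerHom A 1
      rw [map_mul_map_one, ha, cornerHom_one]
    · rintro y z ⟨g, hg⟩ ⟨g', hg'⟩
      exact ⟨g + g', by rw [smul_add, hg, hg', indMk_add]⟩
  have he g : χ (indMk _ g ε) (inA A 1) = g := by
    rw [hχ']
    change op ((1 : A) * 1) • g = g
    simp
  let f := (HomM.resEquiv G).toLinearMap ∘ₗ resMap (cornerHom A) χ
  refine ⟨χ, LinearEquiv.ofBijective f ⟨?_, ?_⟩, fun _ => rfl, fun n π => ?_⟩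
  · rw [← LinearMap.ker_eq_bot, LinearMap.ker_eq_bot']
    rintro ⟨_, y, rfl⟩ hy
    obtain ⟨g, hg⟩ := hsurj y
    refine Subtype.ext (hg.trans ?_)
    have hy : χ (op (cornerHom A 1) • y) (inA A 1) = 0 := hy
    rw [hg, he] at hy
    rw [hy, indMk_zero]
    rfl
  · exact fun g => ⟨⟨_, hε g⟩, he g⟩
  · refine LinearMap.ext fun h => ?_
    rw [HomM.eq_sum_mulLeft h, map_sum, map_sum]
    refine Finset.sum_congr rfl fun i _ => HomM.ext fun m => ?_
    rw [LinearMap.comp_apply, indCover_mulLeft, hχ', HomM.map_apply, HomM.mulLeft_apply, map_smul]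
    rfl

/-- If `G ⊗_A εC` is projective, then so is `G`: the restriction of a splitting of
`Hom_A(M, A ^ n) → G ⊗_A εC` splits `A ^ n → G`. -/
theorem projective_of_projective_ind {n : ℕ} {π : (Fin n → A) →ₗ[Aᵐᵒᵖ] G}
    (hπ : Function.Surjective π)
    (h : Module.Projective (CMAuslanderAlgebra A)ᵐᵒᵖ (ind (cornerHom A) G)) :
    Module.Projective Aᵐᵒᵖ G := by
  obtain ⟨χ, e, he, hχ⟩ := exists_ind_to_homM (A := A) G
  obtain ⟨s, hs⟩ := Module.projective_lifting_property (indCover π) .id (indCover_surjective hπ)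
  refine Module.Projective.of_split ((HomM.resEquiv (Fin n → A)).toLinearMap ∘ₗ
    resMap (cornerHom A) s ∘ₗ e.symm.toLinearMap) π (LinearMap.ext fun g => ?_)
  refine Eq.trans ?_ (e.apply_symm_apply g)
  rw [he]
  change HomM.map π (s (e.symm g)) (inA A 1) = χ (e.symm g) (inA A 1)
  rw [← hχ]
  change χ ((indCover π ∘ₗ s) (e.symm g)) _ = _
  rw [hs]
  rfl

/-- If `G` and `G ⊗_A εC` are Gorenstein-projective, then the latter is projective. The second
syzygy `K` of `G` is Gorenstein-projective, so that `Hom_A(M, K)` is projective, and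
`0 → Hom_A(M, K) → Hom_A(M, A ^ m) → Hom_A(M, A ^ n) → G ⊗_A εC → 0`
is a projective resolution. -/
theorem projective_ind_of_isGorensteinProjective [IsArtinianRing Aᵐᵒᵖ]
    (hG : IsGorensteinProjective A G)
    (h : IsGorensteinProjective (CMAuslanderAlgebra A) (ind (cornerHom A) G)) :
    Module.Projective (CMAuslanderAlgebra A)ᵐᵒᵖ (ind (cornerHom A) G) := by
  have := hG.finite
  obtain ⟨n, π, hπ⟩ := exists_free_cover (A := A) G
  have gp₁ : IsGorensteinProjective A (LinearMap.ker π) := by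
    have h := (hG.congr (π.quotKerEquivOfSurjective hπ).symm).ker (LinearMap.ker π).mkQ
      (Submodule.mkQ_surjective _)
    rwa [Submodule.ker_mkQ] at h
  have := gp₁.finite
  obtain ⟨m, d, hd⟩ := exists_free_cover (A := A) (LinearMap.ker π)
  have gp₂ := gp₁.ker d hd
  have free (n : ℕ) : IsSummandOfPower Aᵐᵒᵖ (CMGenerator A) (Fin n → A) :=
    .pi fun _ => .of_retract (inA A) (prA A) rfl
  refine h.projective_of_resolution (d₂ := HomM.map (LinearMap.ker d).subtype)
    (d₁ := HomM.map ((LinearMap.ker π).subtype ∘ₗ d)) (π := indCover π)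
    (HomM.map_injective Subtype.val_injective) (HomM.map_exact ?_ Subtype.val_injective)
    (indCover_exact hπ ?_) (indCover_surjective hπ) (HomM.isSummandOfPower (free n))
    (HomM.isSummandOfPower (free m)) (HomM.isSummandOfPower gp₂.isSummandOfPower)
  · intro x
    refine Subtype.ext_iff.symm.trans (?_ : d x = 0 ↔ _)
    exact ⟨fun hx => ⟨⟨x, hx⟩, rfl⟩, fun ⟨y, hy⟩ => hy ▸ y.2⟩
  · intro x
    constructor
    · intro hx
      obtain ⟨y, hy⟩ := hd ⟨x, hx⟩
      exact ⟨y, congrArg Subtype.val hy⟩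
    · rintro ⟨y, rfl⟩
      exact (d y).2

end IndCM

end GentleCM

end

theorem proposition2 {k : Type*} [Field k] [IsAlgClosed k]
    {V : Type*} [Fintype V] [Quiver V] [∀ a b : V, Finite (a ⟶ b)]
    (I : TwoSidedIdeal (PathAlgebra k V)) (hI : IsGentleAlgebra I)
    (G : Type*) [AddCommGroup G] [Module (BoundQuiverAlgebra I)ᵐᵒᵖ G]
    (hG : IsIndecomposable (BoundQuiverAlgebra I)ᵐᵒᵖ G)
    (hGp : IsGorensteinProjective (BoundQuiverAlgebra I) G)
    (hGn : ¬ Module.Projective (BoundQuiverAlgebra I)ᵐᵒᵖ G) :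
    let A := BoundQuiverAlgebra I
    let C := CMAuslanderAlgebra A
    let j : A →ₙ+* C := cornerHom A
    -- the vertex `v` that corresponds to `G`
    ∃ v : GVertex A, (∀ w : GVertex A, Nonempty (w.Mod ≃ₗ[Aᵐᵒᵖ] G) ↔ w = v) ∧
      -- (1) the indecomposable projective module `e_v C` and its restriction
      (Module.Projective Cᵐᵒᵖ (rightIdeal (vertexIdempotent v)) ∧
        IsIndecomposable Cᵐᵒᵖ (rightIdeal (vertexIdempotent v)) ∧
        IsGorensteinProjective A (res j (rightIdeal (vertexIdempotent v))) ∧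
        Nonempty (res j (rightIdeal (vertexIdempotent v)) ≃ₗ[Aᵐᵒᵖ] G)) ∧
      -- (2) the induced module `G ⊗_A ε⋆ C` and its restriction
      (¬ Module.Projective Cᵐᵒᵖ (ind j G) ∧
        ¬ IsGorensteinProjective C (ind j G) ∧
        IsGorensteinProjective A (res j (ind j G)) ∧
        Nonempty (res j (ind j G) ≃ₗ[Aᵐᵒᵖ] G)) := by
  intro A C j
  have hfin : Module.Finite k Aᵐᵒᵖ :=
    have : Module.Finite k A := hI.finiteDimensional
    Module.Finite.equiv (MulOpposite.opLinearEquiv k)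
  have hart : IsArtinianRing Aᵐᵒᵖ := IsArtinianRing.of_finite k Aᵐᵒᵖ
  obtain ⟨v, ⟨e⟩⟩ := exists_gVertex G hG hGp hGn
  have := hGp.finite
  obtain ⟨n, π, hπ⟩ := exists_free_cover (A := A) G
  have hproj : ¬ Module.Projective Cᵐᵒᵖ (ind j G) := fun h =>
    hGn (projective_of_projective_ind hπ h)
  let e₁ := ((resCongr j (rightIdealVertexEquiv v)).trans (HomM.resEquiv v.Mod)).trans e
  obtain ⟨-, e₂, -⟩ := exists_ind_to_homM (A := A) G
  refine ⟨v, fun w => ⟨fun ⟨f⟩ => GVertex.eq_of_equiv (f.trans e.symm), ?_⟩,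
    ⟨?_, ?_, hGp.congr e₁.symm, ⟨e₁⟩⟩, hproj,
    fun h => hproj (projective_ind_of_isGorensteinProjective hGp h), hGp.congr e₂.symm, ⟨e₂⟩⟩
  · rintro rfl
    exact ⟨e⟩
  · obtain ⟨n, i, r, hr⟩ := HomM.isSummandOfPower (A := A) (N := v.Mod)
      (.of_retract (CMGenerator.inG v) (CMGenerator.prG v) (LinearMap.ext (CMGenerator.prG_inG v)))
    have := Module.Projective.of_split i r hr
    exact Module.Projective.of_equiv (rightIdealVertexEquiv v).symm
  · exact (HomM.isIndecomposable _ _ (CMGenerator.prG_inG v) (hG.congr e.symm)).congr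
      (rightIdealVertexEquiv v).symm
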